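/- Let $G$ be a unimodular locally compact second countable (Hausdorff) group with Haar measure $dg$, let $H$ be a countable discrete group with counting measure, and let $(X,\mu)$ be a measure space with $0<\mu(X)<\infty$ on which $G$ acts measurably and $\mu$-preservingly. Let $\alpha:G\times X\to H$ be a measurable cocycle, i.e. $\alpha(g_1g_2,x)=\alpha(g_1,g_2x)\,\alpha(g_2,x)$ for all $g_1,g_2\in G$, $x\in X$. Let $\mathcal L(G)\subset B(L_2(G))$ be the von Neumann algebra generated by the left regular representation $\lambda$, with $\lambda(f)=\int_G f(g)\lambda_g\,dg$ for $f\in C_c(G)$. Let $K=H\times G$ act on $X$ by $(h,g)x=gx$, and put $\theta_k\varphi(x)=\varphi(k^{-1}x)$. Let $C_c(K,L_\infty(X))\subset L_2(K,L_2(X))$ be the space of compactly supported weak*-continuous functions $K\to L_\infty(X)$, with the product $$(\xi*\eta)(k)=\int_K\theta_s\big(\xi(ks)\big)\,\eta(s^{-1})\,ds .$$ Let $\mathfrak B'$ be the set of right bounded vectors (those $\eta\in L_2(K,L_2(X))$ for which there is $C$ with $\|\xi*\eta\|_2\le C\|\xi\|_2$ for all $\xi\in C_c(K,L_\infty(X))$)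 and $\mathfrak B$ the set of left bounded vectors (those $\xi\in L_2(K,L_2(X))$ for which there is $C$ with $\|\xi*\eta\|_2\le C\|\eta\|_2$ for all $\eta\in\mathfrak B'$). For $\xi\in\mathfrak B$ let $\pi_l(\xi)$ be the bounded operator on $L_2(K,L_2(X))$ with $\pi_l(\xi)\eta=\xi*\eta$ for all $\eta\in\mathfrak B'$. The crossed product $L_\infty(X)\rtimes(H\times G)$ is the von Neumann algebra generated by $\pi_l(C_c(K,L_\infty(X)))$. On its positive part put $\tau(x)=\|\xi\|_2^2$ if $x=\pi_l(\xi)^*\pi_l(\xi)$ for some $\xi\in\mathfrak B$, and $\tau(x)=\infty$ otherwise. Let $\tau_G$ be the trace on $\mathcal L(G)_+$ defined in the same way from the Hilbert algebra $C_c(G)$ with the product $(f_1*f_2)(g)=\int_G f_1(s)f_2(s^{-1}g)\,ds$ (so that $\tau_G(\lambda(f)^*\lambda(f))=\|f\|_2^2$ for $f\in C_c(G)$). For $f\in C_c(G)$ put $\iota_0(f)(h,g,x)=f(g)\,\mathbf 1_{\{\alpha(g,x)=h\}}$. **Proposition.** For every $f\in C_c(G)$ the function $\iota_0(f)$ belongs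 to $\mathfrak B$, and the map $\lambda(f)\mapsto\pi_l(\iota_0(f))$, $f\in C_c(G)$, extends to a (unital) $*$-homomorphism $\iota:\mathcal L(G)\to L_\infty(X)\rtimes(H\times G)$ which is injective, normal (weak*-continuous), and trace-preserving with respect to $\tau_G$ and the normalized trace $\mu(X)^{-1}\tau$, i.e. $\mu(X)^{-1}\,\tau(\iota(x))=\tau_G(x)$ for all $x\in\mathcal L(G)_+$. -/

import Mathlib

open MeasureTheory
open scoped ENNReal NNReal CompactlySupported

noncomputable section

namespace CocycleTransference

/-! ### Von Neumann algebras and the weak* topology -/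

section VonNeumann

variable {E : Type*} [NormedAddCommGroup E] [InnerProductSpace ℂ E] [CompleteSpace E]

/-- The von Neumann algebra generated by a set `S` of bounded operators: the double commutant of
`S ∪ S*`. -/
def generatedVN (S : Set (E →L[ℂ] E)) : VonNeumannAlgebra E where
  toStarSubalgebra := StarSubalgebra.centralizer ℂ (StarSubalgebra.centralizer ℂ S : Set (E →L[ℂ] E))
  centralizer_centralizer' := by
    change Set.centralizer (Set.centralizer
      ((StarSubalgebra.centralizer ℂ (StarSubalgebra.centralizer ℂ S : Set (E →L[ℂ] E)) :
        StarSubalgebra ℂ (E →L[ℂ] E)) : Set (E →L[ℂ] E))) =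
      ((StarSubalgebra.centralizer ℂ (StarSubalgebra.centralizer ℂ S : Set (E →L[ℂ] E)) :
        StarSubalgebra ℂ (E →L[ℂ] E)) : Set (E →L[ℂ] E))
    rw [StarSubalgebra.coe_centralizer_centralizer, Set.centralizer_centralizer_centralizer]

theorem subset_generatedVN (S : Set (E →L[ℂ] E)) :
    S ⊆ ((generatedVN S).toStarSubalgebra : Set (E →L[ℂ] E)) := by
  intro T hT
  change T ∈ ((StarSubalgebra.centralizer ℂ (StarSubalgebra.centralizer ℂ S : Set (E →L[ℂ] E)) :
        StarSubalgebra ℂ (E →L[ℂ] E)) : Set (E →L[ℂ] E))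
  rw [StarSubalgebra.coe_centralizer_centralizer]
  exact Set.subset_centralizer_centralizer (Or.inl hT)

variable (E) in
/-- The weak* (ultraweak, `σ`-weak) topology on `B(E)`: the initial topology of the functionals
`T ↦ ∑ₙ ⟪xₙ, T yₙ⟫` with `∑ₙ ‖xₙ‖² < ∞` and `∑ₙ ‖yₙ‖² < ∞`. -/
def ultraweakTopology : TopologicalSpace (E →L[ℂ] E) :=
  ⨅ (x : ℕ → E) (y : ℕ → E) (_ : Summable fun n => ‖x n‖ ^ 2) (_ : Summable fun n => ‖y n‖ ^ 2),
    TopologicalSpace.induced (fun T : E →L[ℂ] E => ∑' n, inner ℂ (x n) (T (y n))) inferInstance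

/-- The weak* topology of a von Neumann algebra (or a `*`-subalgebra) of `B(E)`. -/
def weakStarTopology (M : StarSubalgebra ℂ (E →L[ℂ] E)) : TopologicalSpace M :=
  TopologicalSpace.induced Subtype.val (ultraweakTopology E)

end VonNeumann

/-! ### Left and right bounded vectors of a Hilbert algebra of functions

The Hilbert algebra is given by a set `A` of vectors of `L²(Ω, m)` and the formula `mul` of its
product, which makes sense for arbitrary functions on `Ω`. -/

section HilbertAlgebra

variable {Ω : Type*} [MeasurableSpace Ω] (m : Measure Ω)
  (mul : (Ω → ℂ) → (Ω → ℂ) → Ω → ℂ) (A : Set (Lp ℂ 2 m))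

/-- The right bounded vectors `𝔅'`: those `η` with `‖ξ * η‖₂ ≤ C ‖ξ‖₂` for all `ξ ∈ A`. -/
def rightBounded : Set (Lp ℂ 2 m) :=
  {η | ∃ C : ℝ≥0, ∀ ξ ∈ A, eLpNorm (mul ξ η) 2 m ≤ C * ‖ξ‖ₑ}

/-- The left bounded vectors `𝔅`: those `ξ` with `‖ξ * η‖₂ ≤ C ‖η‖₂` for all `η ∈ 𝔅'`. -/
def leftBounded : Set (Lp ℂ 2 m) :=
  {ξ | ∃ C : ℝ≥0, ∀ η ∈ rightBounded m mul A, eLpNorm (mul ξ η) 2 m ≤ C * ‖η‖ₑ}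

/-- `IsPiL m mul A ξ T` says that `ξ` is left bounded and that `T = π_l(ξ)`, i.e. `T` is the
bounded operator on `L²(Ω, m)` with `T η = ξ * η` for all right bounded `η`. -/
def IsPiL (ξ : Lp ℂ 2 m) (T : Lp ℂ 2 m →L[ℂ] Lp ℂ 2 m) : Prop :=
  ξ ∈ leftBounded m mul A ∧ ∀ η ∈ rightBounded m mul A, T η =ᵐ[m] mul ξ η

/-- The trace of the Hilbert algebra on positive operators:
`τ(x) = ‖ξ‖²` if `x = π_l(ξ)* π_l(ξ)` with `ξ` left bounded, and `τ(x) = ∞` if there is no such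
`ξ`. -/
def hilbertTrace (x : Lp ℂ 2 m →L[ℂ] Lp ℂ 2 m) : ℝ≥0∞ :=
  ⨅ (ξ : Lp ℂ 2 m) (T : Lp ℂ 2 m →L[ℂ] Lp ℂ 2 m) (_ : IsPiL m mul A ξ T)
    (_ : x = ContinuousLinearMap.adjoint T * T), ‖ξ‖ₑ ^ 2

end HilbertAlgebra

/-! ### The group von Neumann algebra -/

section Group

variable {G : Type*} [Group G] [TopologicalSpace G] [IsTopologicalGroup G]
  [MeasurableSpace G] [BorelSpace G] (ν : Measure G)

/-- Convolution on `G`: `(f₁ * f₂)(g) = ∫ f₁(s) f₂(s⁻¹ g) ds`. -/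
def groupConv (f₁ f₂ : G → ℂ) (g : G) : ℂ :=
  ∫ s, f₁ s * f₂ (s⁻¹ * g) ∂ν

/-- The Hilbert algebra `C_c(G)` inside `L²(G)`. -/
def groupCore : Set (Lp ℂ 2 ν) :=
  {u | ∃ f : C_c(G, ℂ), u =ᵐ[ν] f}

/-- The trace on the positive part of the group von Neumann algebra of `G`. -/
def groupTrace (x : Lp ℂ 2 ν →L[ℂ] Lp ℂ 2 ν) : ℝ≥0∞ :=
  hilbertTrace ν (groupConv ν) (groupCore ν) x

variable [ν.IsMulLeftInvariant]

/-- The left regular representation, `(λ_g η)(s) = η(g⁻¹ s)`. -/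
def leftReg (g : G) : Lp ℂ 2 ν →L[ℂ] Lp ℂ 2 ν :=
  (Lp.compMeasurePreservingₗᵢ ℂ (fun s => g⁻¹ * s)
    (measurePreserving_mul_left ν g⁻¹)).toContinuousLinearMap

/-- The group von Neumann algebra `L(G)`, generated by the left regular representation. -/
def groupVN : VonNeumannAlgebra (Lp ℂ 2 ν) := generatedVN (Set.range (leftReg ν))

theorem norm_leftReg_apply (g : G) (η : Lp ℂ 2 ν) : ‖leftReg ν g η‖ = ‖η‖ :=
  Lp.norm_compMeasurePreserving η _

variable [LocallyCompactSpace G] [T2Space G] [SecondCountableTopology G] [IsFiniteMeasureOnCompacts ν]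

theorem continuous_leftReg_apply (η : Lp ℂ 2 ν) : Continuous fun g => leftReg ν g η := by
  let φ : G → C(G, G) := fun g => ⟨fun s => g⁻¹ * s, by fun_prop⟩
  have hφ : Continuous φ :=
    (ContinuousMap.curry ⟨fun p : G × G => p.1⁻¹ * p.2, by fun_prop⟩).continuous
  exact (continuous_const (y := η)).compMeasurePreservingLp hφ
    (fun g => measurePreserving_mul_left ν g⁻¹) (by simp)

theorem integrable_smul_leftReg (f : C_c(G, ℂ)) (η : Lp ℂ 2 ν) :
    Integrable (fun g => f g • leftReg ν g η) ν := by
  refine Continuous.integrable_of_hasCompactSupport ?_ ?_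
  · exact f.continuous.smul (continuous_leftReg_apply ν η)
  · exact f.hasCompactSupport.smul_right

/-- The operator `λ(f) = ∫ f(g) λ_g dg` on `L²(G)`, for `f ∈ C_c(G)`. -/
def lambdaOp (f : C_c(G, ℂ)) : Lp ℂ 2 ν →L[ℂ] Lp ℂ 2 ν :=
  LinearMap.mkContinuous
    { toFun := fun η => ∫ g, f g • leftReg ν g η ∂ν
      map_add' := fun η ζ => by
        simp only [map_add, smul_add]
        exact integral_add (integrable_smul_leftReg ν f η) (integrable_smul_leftReg ν f ζ)
      map_smul' := fun c η => by
        simp only [map_smul, RingHom.id_apply]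
        rw [← integral_smul]
        simp only [smul_comm c] }
    (∫ g, ‖f g‖ ∂ν)
    (fun η => by
      refine (norm_integral_le_integral_norm _).trans (le_of_eq ?_)
      rw [← integral_mul_const]
      simp only [norm_smul, norm_leftReg_apply])

theorem lambdaOp_apply (f : C_c(G, ℂ)) (η : Lp ℂ 2 ν) :
    lambdaOp ν f η = ∫ g, f g • leftReg ν g η ∂ν := rfl

theorem lambdaOp_mem (f : C_c(G, ℂ)) : lambdaOp ν f ∈ (groupVN ν).toStarSubalgebra := by
  change lambdaOp ν f ∈ StarSubalgebra.centralizer ℂ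
    (StarSubalgebra.centralizer ℂ (Set.range (leftReg ν)) : Set (Lp ℂ 2 ν →L[ℂ] Lp ℂ 2 ν))
  have key : ∀ T ∈ StarSubalgebra.centralizer ℂ (Set.range (leftReg ν)),
      T * lambdaOp ν f = lambdaOp ν f * T := by
    intro T hT
    rw [StarSubalgebra.mem_centralizer_iff] at hT
    ext1 η
    change T (lambdaOp ν f η) = lambdaOp ν f (T η)
    rw [lambdaOp_apply, lambdaOp_apply,
      ← ContinuousLinearMap.integral_comp_comm T (integrable_smul_leftReg ν f η)]
    refine integral_congr_ae (Filter.Eventually.of_forall fun g => ?_)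
    have h := congrArg (fun S : Lp ℂ 2 ν →L[ℂ] Lp ℂ 2 ν => S η) (hT _ ⟨g, rfl⟩).1
    change leftReg ν g (T η) = T (leftReg ν g η) at h
    change T (f g • leftReg ν g η) = f g • leftReg ν g (T η)
    rw [map_smul, h]
  rw [StarSubalgebra.mem_centralizer_iff]
  exact fun T hT => ⟨key T hT, key (star T) (star_mem hT)⟩

/-- `λ(f)` as an element of `L(G)`. -/
def lambdaVN (f : C_c(G, ℂ)) : (groupVN ν).toStarSubalgebra := ⟨lambdaOp ν f, lambdaOp_mem ν f⟩

end Group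

/-! ### The crossed product -/

section CrossedProduct

variable {K X : Type*} [Group K] [TopologicalSpace K] [MeasurableSpace K] [MeasurableSpace X]
  (ρ : K →* Equiv.Perm X) (ν : Measure K) (μ : Measure X)

/-- The product `(ξ * η)(k) = ∫ θ_s(ξ(k s)) η(s⁻¹) ds`, where `(θ_s φ)(x) = φ(s⁻¹ x)` is the action
on functions on `X`; functions `K → (X → ℂ)` are written as functions on `K × X`. -/
def crossedConv (ξ η : K × X → ℂ) (p : K × X) : ℂ :=
  ∫ s, ξ (p.1 * s, ρ s⁻¹ p.2) * η (s⁻¹, p.2) ∂ν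

/-- The Hilbert algebra `C_c(K, L^∞(X))` of weak*-continuous functions `K → L^∞(X)` with compact
support, inside `L²(K × X) = L²(K, L²(X))`. -/
def crossedCore : Set (Lp ℂ 2 (ν.prod μ)) :=
  {u | ∃ ξ : K → Lp ℂ ∞ μ,
    (∀ φ : Lp ℂ 1 μ, Continuous fun k => ∫ x, ξ k x * φ x ∂μ) ∧ HasCompactSupport ξ ∧
    ∀ᵐ k ∂ν, (fun x => u (k, x)) =ᵐ[μ] ξ k}

/-- `IsCrossedPiL ρ ν μ ξ T` says that `ξ ∈ 𝔅` and `T = π_l(ξ)`. -/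
def IsCrossedPiL (ξ : Lp ℂ 2 (ν.prod μ))
    (T : Lp ℂ 2 (ν.prod μ) →L[ℂ] Lp ℂ 2 (ν.prod μ)) : Prop :=
  IsPiL (ν.prod μ) (crossedConv ρ ν) (crossedCore ν μ) ξ T

/-- The crossed product `L^∞(X) ⋊ K`: the von Neumann algebra on `L²(K, L²(X))` generated by
`π_l(C_c(K, L^∞(X)))`. -/
def crossedProduct : VonNeumannAlgebra (Lp ℂ 2 (ν.prod μ)) :=
  generatedVN {T | ∃ ξ ∈ crossedCore ν μ, IsCrossedPiL ρ ν μ ξ T}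

/-- The trace on the positive part of the crossed product. -/
def crossedTrace (x : Lp ℂ 2 (ν.prod μ) →L[ℂ] Lp ℂ 2 (ν.prod μ)) : ℝ≥0∞ :=
  hilbertTrace (ν.prod μ) (crossedConv ρ ν) (crossedCore ν μ) x

end CrossedProduct

/-! ### The embedding attached to a cocycle -/

section Cocycle

variable {G H X : Type*} [Group G] [Group H] [MulAction G X]

/-- The cocycle identity `α(g₁ g₂, x) = α(g₁, g₂ x) α(g₂, x)`. -/
def IsCocycle (α : G × X → H) : Prop :=
  ∀ (g₁ g₂ : G) (x : X), α (g₁ * g₂, x) = α (g₁, g₂ • x) * α (g₂, x)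

variable (G H X) in
/-- The action of `H × G` on `X` which is trivial on `H` and the given action on `G`. -/
def prodAction : H × G →* Equiv.Perm X :=
  (MulAction.toPermHom G X).comp (MonoidHom.snd H G)

open Classical in
/-- `ι₀(f)(h, g, x) = f(g)` if `α(g, x) = h`, and `0` otherwise. -/
def iotaZero (α : G × X → H) (f : G → ℂ) (p : (H × G) × X) : ℂ :=
  if α (p.1.2, p.2) = p.1.1 then f p.1.2 else 0

end Cocycle

end CocycleTransference

end

open CocycleTransference

set_option linter.unusedSectionVars false

noncomputable section

namespace CocycleTransference

/-! The change of variables `(h, g, x) ↦ (h⁻¹ α(g, x), x, g)` preserves the product measures, since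
for fixed `(g, x)` it is an inversion followed by a translation of `H`. It identifies `L²((H × G) ×
X)` with `L²(H × X) ⊗ L²(G)`, and the cocycle identity says exactly that left multiplication by
`ι₀(f)` becomes `1 ⊗ λ(f)` (`isCrossedPiL_iotaLp`). So `ι` is the amplification `S ↦ 1 ⊗ S`
conjugated by this unitary (`iotaOp`). It is a `*`-homomorphism defined on all bounded operators,
and it is injective and ultraweakly continuous. What remains is that it lands in the crossed product
and that it respects the traces.

Membership (`iotaOp_mem_crossedProduct`) is a double commutant argument. An operator commuting with
`1 ⊗ λ_g` for all `g` has matrix entries in the commutant of `λ(G)`, hence commutes with `1 ⊗ S` for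
every `S ∈ L(G)`, so it is enough to treat `ι(λ_g)`. Fix `g` and freeze the cocycle to `c(x) = α(g,
x)`. The functions `f(s) 1{c(x) = h} 1{h ∈ F}` with `F` finite belong to the core. Letting `F`
exhaust `H` and `f` concentrate at `g`, their left multiplications tend strongly to an operator
which the cocycle identity identifies with `ι(λ_g)` (`sliceOp_leftReg`).

Traces (`crossedTrace_iotaOp`): if `x = λ(ξ)* λ(ξ)`, then `ι(x)` is implemented by `ι₀(ξ)`, whose
squared norm is `μ(X) ‖ξ‖²`; this is one inequality. Conversely let `ι(x) = π_l(ζ)* π_l(ζ)` and `y =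
√x`. Right multiplication by `ι₀(f)` has norm at most `‖f‖₁`, so `μ(X) ‖y f‖² = ‖π_l(ζ) ι₀(f)‖² ≤
‖ζ‖²` whenever `‖f‖₁ = 1`. Along an approximate unit the vectors `y f` therefore have a weak limit
point `ξ`, and `y = π_l(ξ)` because `y` commutes with right convolutions
(`exists_isPiL_of_bounded`). -/

/-! ### Amplifications `1 ⊗ S` on a Hilbert sum of copies of one Hilbert space -/

section Amplification

variable {I E F : Type*} [NormedAddCommGroup E] [InnerProductSpace ℂ E] [CompleteSpace E]
  [NormedAddCommGroup F] [InnerProductSpace ℂ F] [CompleteSpace F]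

/-- The operator acting as `S` in each coordinate of an `ℓ²`-sum. -/
def diagonalOp (S : F →L[ℂ] F) : lp (fun _ : I => F) 2 →L[ℂ] lp (fun _ : I => F) 2 :=
  LinearMap.mkContinuous
    { toFun := fun u => ⟨fun i => S (u i), by
        have h : Memℓp (fun i => ‖S‖ • u i) 2 := (lp.memℓp u).const_smul (‖S‖ : ℝ)
        refine h.mono' fun i => ?_
        simpa [norm_smul] using S.le_opNorm (u i)⟩
      map_add' := fun u v => by ext i; exact map_add S (u i) (v i)
      map_smul' := fun c u => by ext i; exact map_smul S c (u i) }
    ‖S‖ (fun u => by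
      have h : ‖((‖S‖ : ℂ)) • u‖ = ‖S‖ * ‖u‖ := by rw [norm_smul]; simp
      rw [← h]
      refine lp.norm_mono (by norm_num) fun i => ?_
      refine (S.le_opNorm (u i)).trans (le_of_eq ?_)
      rw [lp.coeFn_smul, Pi.smul_apply, norm_smul]
      simp)

@[simp] theorem diagonalOp_apply (S : F →L[ℂ] F) (u : lp (fun _ : I => F) 2) (i : I) :
    diagonalOp S u i = S (u i) := rfl

variable (U : E ≃ₗᵢ[ℂ] lp (fun _ : I => F) 2)

/-- The `i`-th coordinate of a vector of a Hilbert sum. -/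
def coordOp (i : I) : E →L[ℂ] F :=
  (lp.evalCLM ℂ (fun _ : I => F) 2 i).comp (U : E →L[ℂ] lp (fun _ : I => F) 2)

@[simp] theorem coordOp_apply (i : I) (u : E) : coordOp U i u = U u i := rfl

open Classical in
/-- The `i`-th embedding into a Hilbert sum. -/
def embedOp (i : I) : F →L[ℂ] E :=
  (U.symm : lp (fun _ : I => F) 2 →L[ℂ] E).comp
    (lp.singleContinuousLinearMap ℂ (fun _ : I => F) 2 i)

/-- The amplification `1 ⊗ S`. -/
def amplify : (F →L[ℂ] F) →⋆ₐ[ℂ] (E →L[ℂ] E) where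
  toFun S := (U.symm : lp (fun _ : I => F) 2 →L[ℂ] E).comp
    ((diagonalOp S).comp (U : E →L[ℂ] lp (fun _ : I => F) 2))
  map_one' := by ext u; simp; apply U.injective; ext i; simp
  map_mul' S T := by ext u; apply U.injective; ext i; simp
  map_zero' := by ext u; apply U.injective; ext i; simp
  map_add' S T := by ext u; apply U.injective; ext i; simp
  commutes' c := by ext u; apply U.injective; ext i; simp [Algebra.algebraMap_eq_smul_one]
  map_star' S := by
    rw [ContinuousLinearMap.star_eq_adjoint, ContinuousLinearMap.star_eq_adjoint,
      ContinuousLinearMap.eq_adjoint_iff]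
    intro u v
    rw [← U.inner_map_map, ← U.inner_map_map]
    simp [lp.inner_eq_tsum, ContinuousLinearMap.adjoint_inner_left]

@[simp] theorem map_amplify_apply (S : F →L[ℂ] F) (u : E) (i : I) :
    U (amplify U S u) i = S (U u i) := by
  simp [amplify]

theorem ext_coord {u v : E} (h : ∀ i, U u i = U v i) : u = v :=
  U.injective (by ext i; exact h i)

theorem amplify_embedOp (S : F →L[ℂ] F) (i : I) (v : F) :
    amplify U S (embedOp U i v) = embedOp U i (S v) := by
  classical
  refine ext_coord U fun j => ?_
  by_cases h : j = i
  · subst h; simp [embedOp]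
  · simp [embedOp, h]

@[simp] theorem map_embedOp_self (i : I) (v : F) : U (embedOp U i v) i = v := by
  simp [embedOp]

theorem amplify_injective [Nonempty I] : Function.Injective (amplify U) := by
  intro S T h
  obtain ⟨i⟩ := ‹Nonempty I›
  ext v
  have := congrArg (fun A : E →L[ℂ] E => U (A (embedOp U i v)) i) h
  simpa using this

/-- Two bounded operators which agree on the summands of a Hilbert sum are equal. -/
theorem ext_embedOp {A B : E →L[ℂ] E} (h : ∀ i v, A (embedOp U i v) = B (embedOp U i v)) :
    A = B := by
  classical
  ext u
  have hs := (lp.hasSum_single (p := 2) (by norm_num) (U u)).mapL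
    (U.symm : lp (fun _ : I => F) 2 →L[ℂ] E)
  have hA := hs.mapL A
  have hB := hs.mapL B
  have e : (U.symm : lp (fun _ : I => F) 2 →L[ℂ] E) (U u) = u := by simp
  rw [e] at hA hB
  refine hA.unique ?_
  convert hB using 2 with i
  exact h i _

/-- The matrix entry of a bounded operator on a Hilbert sum. -/
def entryOp (T : E →L[ℂ] E) (i j : I) : F →L[ℂ] F := (coordOp U i).comp (T.comp (embedOp U j))

theorem entryOp_apply (T : E →L[ℂ] E) (i j : I) (v : F) :
    entryOp U T i j v = U (T (embedOp U j v)) i := rfl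

/-- Two different operators `T`, `T'` are allowed because the operators `sliceOp` below are
amplifications conjugated by two different unitaries, so that commutation with them turns into an
intertwining relation. -/
theorem mul_amplify_eq_iff (T T' : E →L[ℂ] E) (S : F →L[ℂ] F) :
    T * amplify U S = amplify U S * T' ↔
      ∀ i j, entryOp U T i j * S = S * entryOp U T' i j := by
  constructor
  · intro h i j
    ext v
    have := congrArg (fun A : E →L[ℂ] E => U (A (embedOp U j v)) i) h
    simpa [amplify_embedOp, entryOp_apply] using this
  · intro h
    refine ext_embedOp U fun j v => ext_coord U fun i => ?_
    have := congrArg (fun A : F →L[ℂ] F => A v) (h i j)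
    simpa [amplify_embedOp, entryOp_apply] using this

theorem inner_embedOp_left (i : I) (v : F) (u : E) :
    inner ℂ (embedOp U i v) u = inner ℂ v (U u i) := by
  classical
  rw [← U.inner_map_map]
  simp [embedOp, lp.inner_single_left]

theorem inner_embedOp_right (i : I) (v : F) (u : E) :
    inner ℂ u (embedOp U i v) = inner ℂ (U u i) v := by
  rw [← inner_conj_symm, inner_embedOp_left, inner_conj_symm]

theorem adjoint_entryOp (T : E →L[ℂ] E) (i j : I) :
    ContinuousLinearMap.adjoint (entryOp U T i j) =
      entryOp U (ContinuousLinearMap.adjoint T) j i := by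
  symm
  rw [ContinuousLinearMap.eq_adjoint_iff]
  intro v w
  rw [entryOp_apply, entryOp_apply, ← inner_embedOp_right, ← inner_embedOp_left,
    ContinuousLinearMap.adjoint_inner_left]

/-- If the operators of `M` commute with everything commuting with `M₀`, then everything commuting
with the amplification of `M₀` commutes with the amplification of `M`. -/
theorem commute_amplify_of_mem_generatedVN {M₀ : Set (F →L[ℂ] F)} {T : E →L[ℂ] E}
    (hT : ∀ S ∈ M₀, T * amplify U S = amplify U S * T)
    (hT' : ∀ S ∈ M₀, star T * amplify U S = amplify U S * star T)
    {S : F →L[ℂ] F} (hS : S ∈ (generatedVN M₀).toStarSubalgebra) :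
    T * amplify U S = amplify U S * T := by
  rw [mul_amplify_eq_iff]
  intro i j
  change S ∈ StarSubalgebra.centralizer ℂ (StarSubalgebra.centralizer ℂ M₀ : Set (F →L[ℂ] F)) at hS
  rw [StarSubalgebra.mem_centralizer_iff] at hS
  refine (hS _ ?_).1
  rw [SetLike.mem_coe, StarSubalgebra.mem_centralizer_iff]
  intro R hR
  have h1 := (mul_amplify_eq_iff U T T R).1 (hT R hR) i j
  have h2 := (mul_amplify_eq_iff U _ _ R).1 (hT' R hR) j i
  refine ⟨h1.symm, ?_⟩
  have h3 := congrArg star h2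
  rw [star_mul, star_mul, ContinuousLinearMap.star_eq_adjoint, ContinuousLinearMap.star_eq_adjoint,
    ContinuousLinearMap.star_eq_adjoint, adjoint_entryOp, ContinuousLinearMap.adjoint_adjoint] at h3
  rw [ContinuousLinearMap.star_eq_adjoint]
  exact h3

theorem hasSum_norm_sq_coord (u : E) : HasSum (fun i => ‖U u i‖ ^ 2) (‖u‖ ^ 2) := by
  have h := lp.hasSum_norm (p := 2) (by norm_num) (U u)
  simpa using h

theorem hasSum_inner_amplify (S : F →L[ℂ] F) (u v : E) :
    HasSum (fun i => inner ℂ (U u i) (S (U v i))) (inner ℂ u (amplify U S v)) := by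
  have h := lp.hasSum_inner (𝕜 := ℂ) (U u) (U (amplify U S v))
  simpa using h

theorem summable_norm_sq_coord {x : ℕ → E} (hx : Summable fun n => ‖x n‖ ^ 2) :
    Summable fun p : ℕ × I => ‖U (x p.1) p.2‖ ^ 2 := by
  refine (summable_prod_of_nonneg fun p => by positivity).2
    ⟨fun n => (hasSum_norm_sq_coord U (x n)).summable, ?_⟩
  simpa [(hasSum_norm_sq_coord U _).tsum_eq] using hx

theorem summable_inner_of_summable_sq {J : Type*} {x y : J → F} (S : F →L[ℂ] F)
    (hx : Summable fun n => ‖x n‖ ^ 2) (hy : Summable fun n => ‖y n‖ ^ 2) :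
    Summable fun n => inner ℂ (x n) (S (y n)) := by
  refine Summable.of_norm_bounded ((hx.add hy).mul_left ‖S‖) fun n => ?_
  have h1 : ‖inner ℂ (x n) (S (y n))‖ ≤ ‖x n‖ * (‖S‖ * ‖y n‖) :=
    (norm_inner_le_norm _ _).trans (by gcongr; exact S.le_opNorm _)
  nlinarith [norm_nonneg S, sq_nonneg (‖x n‖ - ‖y n‖), mul_nonneg (norm_nonneg S)
    (sq_nonneg (‖x n‖ - ‖y n‖)), mul_nonneg (norm_nonneg S)
    (add_nonneg (sq_nonneg ‖x n‖) (sq_nonneg ‖y n‖))]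

/-- The index set of an orthonormal basis of `L²(H × X)` may be uncountable, whereas ultraweak
functionals are indexed by `ℕ`. A square summable family has countable support, which embeds in `ℕ`;
the rest is filled with zeros. -/
theorem exists_countable_reindex {J : Type*} {x y : J → F}
    (hx : Summable fun n => ‖x n‖ ^ 2) (hy : Summable fun n => ‖y n‖ ^ 2) :
    ∃ x' y' : ℕ → F, (Summable fun n => ‖x' n‖ ^ 2) ∧ (Summable fun n => ‖y' n‖ ^ 2) ∧
      ∀ S : F →L[ℂ] F, ∑' j, inner ℂ (x j) (S (y j)) = ∑' n, inner ℂ (x' n) (S (y' n)) := by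
  set s := Function.support fun n => ‖x n‖ ^ 2 with hs
  have hc : s.Countable := hx.countable_support
  have : Countable s := hc
  obtain ⟨e, he⟩ := exists_injective_nat s
  have key (z : J → F) (hz : Summable fun n => ‖z n‖ ^ 2) :
      Summable fun n => ‖Function.extend e (fun j : s => z j) 0 n‖ ^ 2 := by
    have h1 : Summable fun j : s => ‖z j‖ ^ 2 := hz.comp_injective Subtype.val_injective
    refine (he.summable_iff fun n hn => ?_).1 ?_
    · rw [Function.extend_apply' _ _ _ hn]
      simp
    · convert h1 using 2 with j
      simp [he.extend_apply]
  refine ⟨Function.extend e (fun j : s => x j) 0, Function.extend e (fun j : s => y j) 0,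
    key x hx, key y hy, fun S => ?_⟩
  have h1 : ∑' j : s, inner ℂ (x j) (S (y j)) = ∑' j, inner ℂ (x j) (S (y j)) := by
    refine tsum_subtype_eq_of_support_subset (f := fun j => inner ℂ (x j) (S (y j)))
      fun j hj => ?_
    rw [hs, Function.mem_support]
    intro h
    apply hj
    have : x j = 0 := by simpa using h
    simp [this]
  rw [← h1, ← he.tsum_eq (f := fun n => inner ℂ (Function.extend e (fun j : s => x j) 0 n)
    (S (Function.extend e (fun j : s => y j) 0 n)))]
  · simp [he.extend_apply]
  · intro n hn
    by_contra hne
    apply hn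
    change inner ℂ (Function.extend e (fun j : s => x j) 0 n) _ = 0
    rw [Function.extend_apply' _ _ _ hne]
    simp

/-- Expanding every vector in coordinates turns `∑ ⟪xₙ, (1 ⊗ S) yₙ⟫` into a double sum of `⟪xₙᵢ, S
yₙᵢ⟫`, again with square summable families. -/
theorem exists_functional_amplify {x y : ℕ → E}
    (hx : Summable fun n => ‖x n‖ ^ 2) (hy : Summable fun n => ‖y n‖ ^ 2) :
    ∃ x' y' : ℕ → F, (Summable fun n => ‖x' n‖ ^ 2) ∧ (Summable fun n => ‖y' n‖ ^ 2) ∧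
      ∀ S : F →L[ℂ] F, ∑' n, inner ℂ (x n) (amplify U S (y n)) =
        ∑' n, inner ℂ (x' n) (S (y' n)) := by
  obtain ⟨x', y', hx', hy', h⟩ := exists_countable_reindex
    (summable_norm_sq_coord U hx) (summable_norm_sq_coord U hy)
  refine ⟨x', y', hx', hy', fun S => ?_⟩
  rw [← h S, (summable_inner_of_summable_sq S (summable_norm_sq_coord U hx)
    (summable_norm_sq_coord U hy)).tsum_prod]
  exact tsum_congr fun n => ((hasSum_inner_amplify U S (x n) (y n)).tsum_eq).symm

/-- The amplification is continuous for the ultraweak topologies. -/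
theorem continuous_ultraweak_amplify :
    @Continuous _ _ (ultraweakTopology F) (ultraweakTopology E) (amplify U) := by
  let _ := ultraweakTopology F
  refine continuous_iInf_rng.2 fun x => continuous_iInf_rng.2 fun y =>
    continuous_iInf_rng.2 fun hx => continuous_iInf_rng.2 fun hy => continuous_induced_rng.2 ?_
  obtain ⟨x', y', hx', hy', h⟩ := exists_functional_amplify U hx hy
  have : (fun T : E →L[ℂ] E => ∑' n, inner ℂ (x n) (T (y n))) ∘ amplify U =
      fun S : F →L[ℂ] F => ∑' n, inner ℂ (x' n) (S (y' n)) := funext h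
  rw [this]
  exact continuous_iff_le_induced.2
    (iInf_le_of_le x' (iInf_le_of_le y' (iInf_le_of_le hx' (iInf_le _ hy'))))

end Amplification

/-! ### `L²` of a product space as a Hilbert sum -/

section Tensor

variable {Y Z : Type*} [MeasurableSpace Y] [MeasurableSpace Z] {κ : Measure Y} {ν : Measure Z}
  [SigmaFinite κ] [SigmaFinite ν]

theorem ae_memLp_fiber (u : Lp ℂ 2 (κ.prod ν)) :
    ∀ᵐ y ∂κ, MemLp (fun z => u (y, z)) 2 ν := by
  have h := (memLp_two_iff_integrable_sq_norm (Lp.aestronglyMeasurable u)).1 (Lp.memLp u)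
  filter_upwards [h.prod_right_ae] with y hy
  exact (memLp_two_iff_integrable_sq_norm
    ((Lp.stronglyMeasurable u).comp_measurable measurable_prodMk_left).aestronglyMeasurable).2 hy

open Classical in
/-- The fibre `u(y, ·)` of a square integrable function on a product. -/
def fiber (u : Lp ℂ 2 (κ.prod ν)) (y : Y) : Lp ℂ 2 ν :=
  if h : MemLp (fun z => u (y, z)) 2 ν then h.toLp _ else 0

theorem coeFn_fiber (u : Lp ℂ 2 (κ.prod ν)) :
    ∀ᵐ y ∂κ, fiber u y =ᵐ[ν] fun z => u (y, z) := by
  filter_upwards [ae_memLp_fiber u] with y hy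
  rw [fiber, dif_pos hy]
  exact hy.coeFn_toLp

theorem memLp_tensor (b : Lp ℂ 2 κ) (v : Lp ℂ 2 ν) :
    MemLp (fun p : Y × Z => b p.1 * v p.2) 2 (κ.prod ν) := by
  have hm : AEStronglyMeasurable (fun p : Y × Z => b p.1 * v p.2) (κ.prod ν) :=
    (((Lp.stronglyMeasurable b).comp_measurable measurable_fst).mul
      ((Lp.stronglyMeasurable v).comp_measurable measurable_snd)).aestronglyMeasurable
  rw [memLp_two_iff_integrable_sq_norm hm]
  simp only [norm_mul, mul_pow]
  exact ((memLp_two_iff_integrable_sq_norm (Lp.aestronglyMeasurable b)).1 (Lp.memLp b)).mul_prod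
    ((memLp_two_iff_integrable_sq_norm (Lp.aestronglyMeasurable v)).1 (Lp.memLp v))

/-- The elementary tensor `b ⊗ v`, i.e. the function `(y, z) ↦ b(y) v(z)`. -/
def tensorLp (b : Lp ℂ 2 κ) (v : Lp ℂ 2 ν) : Lp ℂ 2 (κ.prod ν) := (memLp_tensor b v).toLp _

theorem coeFn_tensorLp (b : Lp ℂ 2 κ) (v : Lp ℂ 2 ν) :
    tensorLp b v =ᵐ[κ.prod ν] fun p => b p.1 * v p.2 := (memLp_tensor b v).coeFn_toLp

theorem fiber_tensorLp (b : Lp ℂ 2 κ) (v : Lp ℂ 2 ν) :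
    ∀ᵐ y ∂κ, fiber (tensorLp b v) y = b y • v := by
  filter_upwards [coeFn_fiber (tensorLp b v), Measure.ae_ae_of_ae_prod (coeFn_tensorLp b v)]
    with y h1 h2
  refine Lp.ext ?_
  filter_upwards [h1, h2, Lp.coeFn_smul (b y) v] with z e1 e2 e3
  rw [e1, e2, e3]; rfl

theorem inner_tensorLp_aux (b : Lp ℂ 2 κ) (v : Lp ℂ 2 ν) (u : Lp ℂ 2 (κ.prod ν)) :
    Integrable (fun y => inner ℂ (b y) (inner ℂ v (fiber u y))) κ ∧
      inner ℂ (tensorLp b v) u = ∫ y, inner ℂ (b y) (inner ℂ v (fiber u y)) ∂κ := by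
  have hi := L2.integrable_inner (𝕜 := ℂ) (tensorLp b v) u
  have he : (fun y => ∫ z, inner ℂ (tensorLp b v (y, z)) (u (y, z)) ∂ν) =ᵐ[κ]
      fun y => inner ℂ (b y) (inner ℂ v (fiber u y)) := by
    filter_upwards [coeFn_fiber u, Measure.ae_ae_of_ae_prod (coeFn_tensorLp b v)] with y h1 h2
    rw [L2.inner_def, RCLike.inner_apply, ← integral_mul_const]
    refine integral_congr_ae ?_
    filter_upwards [h1, h2] with z e1 e2
    rw [e1, e2]
    simp only [RCLike.inner_apply, map_mul]
    ring
  refine ⟨hi.integral_prod_left.congr he, ?_⟩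
  rw [L2.inner_def, integral_prod _ hi]
  exact integral_congr_ae he

theorem inner_tensorLp (b : Lp ℂ 2 κ) (v : Lp ℂ 2 ν) (u : Lp ℂ 2 (κ.prod ν)) :
    inner ℂ (tensorLp b v) u = ∫ y, inner ℂ (b y) (inner ℂ v (fiber u y)) ∂κ :=
  (inner_tensorLp_aux b v u).2

theorem inner_tensorLp_tensorLp (b b' : Lp ℂ 2 κ) (v v' : Lp ℂ 2 ν) :
    inner ℂ (tensorLp b v) (tensorLp b' v') = inner ℂ b b' * inner ℂ v v' := by
  rw [inner_tensorLp, L2.inner_def, ← integral_mul_const]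
  refine integral_congr_ae ?_
  filter_upwards [fiber_tensorLp b' v'] with y hy
  rw [hy, inner_smul_right]
  simp only [RCLike.inner_apply]
  ring

theorem norm_tensorLp (b : Lp ℂ 2 κ) (v : Lp ℂ 2 ν) : ‖tensorLp b v‖ = ‖b‖ * ‖v‖ := by
  have h := inner_tensorLp_tensorLp b b v v
  rw [inner_self_eq_norm_sq_to_K, inner_self_eq_norm_sq_to_K, inner_self_eq_norm_sq_to_K] at h
  have h' : ‖tensorLp b v‖ ^ 2 = ‖b‖ ^ 2 * ‖v‖ ^ 2 := by
    apply Complex.ofReal_injective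
    rw [Complex.ofReal_mul, Complex.ofReal_pow, Complex.ofReal_pow, Complex.ofReal_pow]
    exact h
  rw [← mul_pow] at h'
  exact (sq_eq_sq₀ (norm_nonneg _) (by positivity)).1 h'

/-- Tensoring with a fixed vector on the right. -/
def tensorRight (v : Lp ℂ 2 ν) : Lp ℂ 2 κ →L[ℂ] Lp ℂ 2 (κ.prod ν) :=
  LinearMap.mkContinuous
    { toFun := fun b => tensorLp b v
      map_add' := fun b c => by
        refine Lp.ext ?_
        filter_upwards [coeFn_tensorLp (b + c) v, coeFn_tensorLp b v, coeFn_tensorLp c v,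
          Lp.coeFn_add (tensorLp b v) (tensorLp c v),
          Measure.quasiMeasurePreserving_fst.ae (Lp.coeFn_add b c)] with p h1 h2 h3 h4 h5
        rw [h1, h4, Pi.add_apply, h2, h3, h5, Pi.add_apply, add_mul]
      map_smul' := fun c b => by
        refine Lp.ext ?_
        filter_upwards [coeFn_tensorLp (c • b) v, coeFn_tensorLp b v,
          Lp.coeFn_smul c (tensorLp b v),
          Measure.quasiMeasurePreserving_fst.ae (Lp.coeFn_smul c b)] with p h1 h2 h4 h5
        simp only [RingHom.id_apply]
        rw [h1, h4, Pi.smul_apply, h2, h5, Pi.smul_apply, smul_eq_mul, smul_eq_mul, mul_assoc] }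
    ‖v‖ fun b => by
      change ‖tensorLp b v‖ ≤ _
      rw [norm_tensorLp, mul_comm]

theorem tensorRight_apply (b : Lp ℂ 2 κ) (v : Lp ℂ 2 ν) : tensorRight v b = tensorLp b v := rfl

/-- Taking `b` to be indicators of sets of finite measure recovers the integrals of both sides over
such sets. The freedom to change `v` as well as `u` is what lets an adjoint be moved from one to the
other in `fiber_ampl`. -/
theorem ae_inner_fiber_eq {v v' : Lp ℂ 2 ν} {u u' : Lp ℂ 2 (κ.prod ν)}
    (h : ∀ b : Lp ℂ 2 κ, inner ℂ (tensorLp b v) u = inner ℂ (tensorLp b v') u') :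
    (fun y => inner ℂ v (fiber u y)) =ᵐ[κ] fun y => inner ℂ v' (fiber u' y) := by
  have key (s : Set Y) (hs : MeasurableSet s) (hs' : κ s < ∞) (w : Lp ℂ 2 ν)
      (u : Lp ℂ 2 (κ.prod ν)) :
      IntegrableOn (fun y => inner ℂ w (fiber u y)) s κ ∧
      inner ℂ (tensorLp (indicatorConstLp 2 hs hs'.ne (1 : ℂ)) w) u =
        ∫ y in s, inner ℂ w (fiber u y) ∂κ := by
    obtain ⟨h1, h2⟩ := inner_tensorLp_aux (indicatorConstLp 2 hs hs'.ne (1 : ℂ)) w u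
    have e : (fun y => inner ℂ ((indicatorConstLp 2 hs hs'.ne (1 : ℂ) : Lp ℂ 2 κ) y)
        (inner ℂ w (fiber u y))) =ᵐ[κ] s.indicator fun y => inner ℂ w (fiber u y) := by
      filter_upwards [indicatorConstLp_coeFn (p := 2) (hs := hs) (hμs := hs'.ne) (c := (1 : ℂ))]
        with y hy
      rw [hy]
      by_cases hys : y ∈ s <;> simp [hys]
    exact ⟨(integrable_indicator_iff hs).1 (h1.congr e),
      by rw [h2, integral_congr_ae e, integral_indicator hs]⟩
  refine ae_eq_of_forall_setIntegral_eq_of_sigmaFinite (fun s hs hs' => (key s hs hs' v u).1)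
    (fun s hs hs' => (key s hs hs' v' u').1) fun s hs hs' => ?_
  rw [← (key s hs hs' v u).2, ← (key s hs hs' v' u').2, h]

theorem eq_of_ae_fiber_eq {u u' : Lp ℂ 2 (κ.prod ν)} (h : fiber u =ᵐ[κ] fiber u') : u = u' := by
  refine Lp.ext ?_
  have hm : MeasurableSet {p : Y × Z | u p = u' p} :=
    (Lp.stronglyMeasurable u).measurableSet_eq_fun (Lp.stronglyMeasurable u')
  refine (Measure.ae_prod_iff_ae_ae hm).2 ?_
  filter_upwards [h, coeFn_fiber u, coeFn_fiber u'] with y hy h1 h2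
  filter_upwards [h1, h2] with z e1 e2
  rw [← e1, ← e2, hy]

/-- Tensoring with a unit vector is an isometric embedding. -/
def tensorUnit (b : Lp ℂ 2 κ) (hb : ‖b‖ = 1) : Lp ℂ 2 ν →ₗᵢ[ℂ] Lp ℂ 2 (κ.prod ν) where
  toFun v := tensorLp b v
  map_add' v w := by
    refine Lp.ext ?_
    filter_upwards [coeFn_tensorLp b (v + w), coeFn_tensorLp b v, coeFn_tensorLp b w,
      Lp.coeFn_add (tensorLp b v) (tensorLp b w),
      Measure.quasiMeasurePreserving_snd.ae (Lp.coeFn_add v w)] with p h1 h2 h3 h4 h5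
    rw [h1, h4, Pi.add_apply, h2, h3, h5, Pi.add_apply, mul_add]
  map_smul' c v := by
    refine Lp.ext ?_
    filter_upwards [coeFn_tensorLp b (c • v), coeFn_tensorLp b v,
      Lp.coeFn_smul c (tensorLp b v),
      Measure.quasiMeasurePreserving_snd.ae (Lp.coeFn_smul c v)] with p h1 h2 h4 h5
    simp only [RingHom.id_apply]
    rw [h1, h4, Pi.smul_apply, h2, h5, Pi.smul_apply, smul_eq_mul, smul_eq_mul, mul_left_comm]
  norm_map' v := by
    change ‖tensorLp b v‖ = ‖v‖
    rw [norm_tensorLp, hb, one_mul]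

theorem tensorUnit_apply (b : Lp ℂ 2 κ) (hb : ‖b‖ = 1) (v : Lp ℂ 2 ν) :
    tensorUnit b hb v = tensorLp b v := rfl

variable [SecondCountableTopology (Lp ℂ 2 ν)]

/-- For totality, a vector orthogonal to all `eᵢ ⊗ v` is orthogonal to all `b ⊗ v`, so almost all
its fibres are orthogonal to any given `v`. Separability of `L²(Z)` makes the exceptional null set
independent of `v`. -/
theorem isHilbertSum_tensorUnit {I : Type*} (e : HilbertBasis I ℂ (Lp ℂ 2 κ)) :
    IsHilbertSum ℂ (fun _ : I => Lp ℂ 2 ν)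
      (fun i => tensorUnit (κ := κ) (ν := ν) (e i) (e.orthonormal.1 i)) := by
  refine IsHilbertSum.mk ?_ ?_
  · intro i j hij v w
    rw [tensorUnit_apply, tensorUnit_apply, inner_tensorLp_tensorLp, e.orthonormal.2 hij, zero_mul]
  · rw [top_le_iff, Submodule.topologicalClosure_eq_top_iff, Submodule.eq_bot_iff]
    intro u hu
    have h0 (v : Lp ℂ 2 ν) : ∀ b : Lp ℂ 2 κ, inner ℂ (tensorLp b v) u = 0 := by
      have h1 (i : I) : inner ℂ (tensorLp (e i) v) u = 0 :=
        (Submodule.mem_orthogonal _ _).1 hu _ (Submodule.mem_iSup_of_mem i ⟨v, rfl⟩)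
      intro b
      have h2 := ((e.hasSum_repr b).mapL (tensorRight v)).mapL (innerSL ℂ u)
      have h3 : inner ℂ u (tensorLp b v) = 0 := by
        refine h2.unique ?_
        convert hasSum_zero using 2 with i
        rw [map_smul, map_smul, tensorRight_apply, innerSL_apply_apply, ← inner_conj_symm, h1]
        simp
      rw [← inner_conj_symm, h3, map_zero]
    have h1 : ∀ v : Lp ℂ 2 ν, (fun y => inner ℂ v (fiber u y)) =ᵐ[κ] 0 := by
      intro v
      refine (ae_inner_fiber_eq (v' := (0 : Lp ℂ 2 ν)) (u' := u) fun b => ?_).trans ?_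
      · rw [h0, h0]
      · filter_upwards with y; simp
    refine eq_of_ae_fiber_eq ?_
    refine (ae_eq_zero_of_forall_inner (𝕜 := ℂ) h1).trans ?_
    refine Filter.EventuallyEq.symm (ae_eq_zero_of_forall_inner (𝕜 := ℂ) fun v => ?_)
    refine (ae_inner_fiber_eq (v' := (0 : Lp ℂ 2 ν)) (u' := u) fun b => ?_).trans ?_
    · rw [h0, inner_zero_right]
    · filter_upwards with y; simp

variable (κ) in
/-- An index set of an orthonormal basis of `L²(Y, κ)`. -/
def TensorIndex : Type _ := (exists_hilbertBasis ℂ (Lp ℂ 2 κ)).choose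

variable (κ) in
/-- An orthonormal basis of `L²(Y, κ)`. -/
def tensorBasis : HilbertBasis (TensorIndex κ) ℂ (Lp ℂ 2 κ) :=
  (exists_hilbertBasis ℂ (Lp ℂ 2 κ)).choose_spec.choose

variable (κ ν) in
/-- `L²(Y × Z)` as a Hilbert sum of copies of `L²(Z)`. -/
def tensorEquiv : Lp ℂ 2 (κ.prod ν) ≃ₗᵢ[ℂ] lp (fun _ : TensorIndex κ => Lp ℂ 2 ν) 2 :=
  (isHilbertSum_tensorUnit (tensorBasis κ)).linearIsometryEquiv

theorem embedOp_tensorEquiv (i : TensorIndex κ) (v : Lp ℂ 2 ν) :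
    embedOp (tensorEquiv κ ν) i v = tensorLp (tensorBasis κ i) v := by
  classical
  have h := (isHilbertSum_tensorUnit (ν := ν) (tensorBasis κ)).linearIsometryEquiv_symm_apply_single
    (i := i) v
  rw [tensorUnit_apply] at h
  rw [← h]
  simp only [embedOp, ContinuousLinearMap.comp_apply, lp.singleContinuousLinearMap_apply]
  congr!

theorem tensorEquiv_tensorLp (b : Lp ℂ 2 κ) (v : Lp ℂ 2 ν) (i : TensorIndex κ) :
    tensorEquiv κ ν (tensorLp b v) i = inner ℂ (tensorBasis κ i) b • v := by
  refine ext_inner_left ℂ fun w => ?_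
  rw [← inner_embedOp_left, embedOp_tensorEquiv, inner_tensorLp_tensorLp, inner_smul_right]

variable (κ) in
/-- The operator `1 ⊗ S` on `L²(Y × Z)`. -/
def ampl : (Lp ℂ 2 ν →L[ℂ] Lp ℂ 2 ν) →⋆ₐ[ℂ] (Lp ℂ 2 (κ.prod ν) →L[ℂ] Lp ℂ 2 (κ.prod ν)) :=
  amplify (tensorEquiv κ ν)

theorem ampl_tensorLp (S : Lp ℂ 2 ν →L[ℂ] Lp ℂ 2 ν) (b : Lp ℂ 2 κ) (v : Lp ℂ 2 ν) :
    ampl κ S (tensorLp b v) = tensorLp b (S v) := by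
  refine ext_coord (tensorEquiv κ ν) fun i => ?_
  rw [ampl, map_amplify_apply, tensorEquiv_tensorLp, tensorEquiv_tensorLp, map_smul]

/-- The operator `1 ⊗ S` acts as `S` on almost every fibre. -/
theorem fiber_ampl (S : Lp ℂ 2 ν →L[ℂ] Lp ℂ 2 ν) (u : Lp ℂ 2 (κ.prod ν)) :
    ∀ᵐ y ∂κ, fiber (ampl κ S u) y = S (fiber u y) := by
  have h (w : Lp ℂ 2 ν) :
      (fun y => inner ℂ w (fiber (ampl κ S u) y - S (fiber u y))) =ᵐ[κ] 0 := by
    -- `⟪b ⊗ w, (1 ⊗ S) u⟫ = ⟪b ⊗ S* w, u⟫`, because the amplification respects adjoints.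
    have h1 := ae_inner_fiber_eq (v := w) (v' := star S w) (u := ampl κ S u) (u' := u) fun b => by
      rw [← ContinuousLinearMap.adjoint_inner_left, ← ContinuousLinearMap.star_eq_adjoint,
        ← map_star, ampl_tensorLp]
    filter_upwards [h1] with y hy
    rw [inner_sub_right, hy, ContinuousLinearMap.star_eq_adjoint,
      ContinuousLinearMap.adjoint_inner_left, sub_self, Pi.zero_apply]
  filter_upwards [ae_eq_zero_of_forall_inner (𝕜 := ℂ) h] with y hy
  exact sub_eq_zero.1 hy

theorem coeFn_ampl (S : Lp ℂ 2 ν →L[ℂ] Lp ℂ 2 ν) (u : Lp ℂ 2 (κ.prod ν)) :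
    ∀ᵐ y ∂κ, ∃ v : Lp ℂ 2 ν, (v =ᵐ[ν] fun z => u (y, z)) ∧
      S v =ᵐ[ν] fun z => ampl κ S u (y, z) := by
  filter_upwards [fiber_ampl S u, coeFn_fiber u, coeFn_fiber (ampl κ S u)] with y h1 h2 h3
  exact ⟨fiber u y, h2, h1 ▸ h3⟩

theorem ampl_injective {b : Lp ℂ 2 κ} (hb : b ≠ 0) : Function.Injective (ampl κ (ν := ν)) := by
  have : Nonempty (TensorIndex κ) := by
    by_contra h
    rw [not_nonempty_iff] at h
    exact hb (((tensorBasis κ).hasSum_repr b).unique hasSum_empty)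
  exact amplify_injective _

end Tensor

/-! ### Bochner integrals of `L²`-valued functions -/

section BochnerLp

variable {S Ω : Type*} [MeasurableSpace S] [MeasurableSpace Ω] {σ : Measure S} {m : Measure Ω}
  [SFinite σ] [SigmaFinite m]

/-- Cauchy–Schwarz on a set of finite measure; it supplies the integrability that Fubini needs in
`coeFn_integral_Lp`. -/
theorem setIntegral_norm_le (u : Lp ℂ 2 m) {A : Set Ω} (hA : m A < ∞) :
    IntegrableOn u A m ∧ ∫ ω in A, ‖u ω‖ ∂m ≤ ‖u‖ * (m A).toReal ^ (1 / 2 : ℝ) := by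
  have : IsFiniteMeasure (m.restrict A) := ⟨by simpa using hA⟩
  have h1 : MemLp u 2 (m.restrict A) := (Lp.memLp u).restrict A
  have h2 : MemLp u 1 (m.restrict A) := h1.mono_exponent one_le_two
  refine ⟨memLp_one_iff_integrable.1 h2, ?_⟩
  rw [integral_norm_eq_lintegral_enorm h1.1, ← eLpNorm_one_eq_lintegral_enorm]
  have h3 : eLpNorm u 1 (m.restrict A) ≤ eLpNorm u 2 m * m A ^ (1 / 2 : ℝ) := by
    refine (eLpNorm_le_eLpNorm_mul_rpow_measure_univ one_le_two h1.1).trans ?_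
    rw [Measure.restrict_apply_univ]
    refine mul_le_mul' (eLpNorm_restrict_le _ _ _ _) (le_of_eq ?_)
    norm_num
  have h4 : eLpNorm u 2 m * m A ^ (1 / 2 : ℝ) ≠ ∞ :=
    ENNReal.mul_ne_top (Lp.memLp u).2.ne (ENNReal.rpow_ne_top_of_nonneg (by norm_num) hA.ne)
  refine (ENNReal.toReal_mono h4 h3).trans (le_of_eq ?_)
  rw [ENNReal.toReal_mul, Lp.norm_def, ENNReal.toReal_rpow]

/-- A Bochner integral in `L²` is a pointwise integral. -/
theorem coeFn_integral_Lp {F : S → Lp ℂ 2 m} (hF : Integrable F σ) {Φ : S × Ω → ℂ}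
    (hΦ : StronglyMeasurable Φ) (h : ∀ᵐ s ∂σ, F s =ᵐ[m] fun ω => Φ (s, ω)) :
    (∫ s, F s ∂σ : Lp ℂ 2 m) =ᵐ[m] fun ω => ∫ s, Φ (s, ω) ∂σ := by
  have hi (A : Set Ω) (hA : m A < ∞) : Integrable Φ (σ.prod (m.restrict A)) := by
    refine (integrable_prod_iff hΦ.aestronglyMeasurable).2 ⟨?_, ?_⟩
    · filter_upwards [h] with s hs
      exact (setIntegral_norm_le (F s) hA).1.congr (ae_restrict_of_ae hs)
    · refine (hF.norm.mul_const ((m A).toReal ^ (1 / 2 : ℝ))).mono'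
        hΦ.norm.integral_prod_right.aestronglyMeasurable ?_
      filter_upwards [h] with s hs
      rw [Real.norm_of_nonneg (integral_nonneg fun _ => norm_nonneg _)]
      refine le_trans (le_of_eq ?_) (setIntegral_norm_le (F s) hA).2
      refine integral_congr_ae ?_
      filter_upwards [ae_restrict_of_ae hs] with ω hω
      rw [hω]
  refine ae_eq_of_forall_setIntegral_eq_of_sigmaFinite
    (fun A _ hA => (setIntegral_norm_le _ hA).1) (fun A _ hA => (hi A hA).integral_prod_right)
    fun A hAm hA => ?_
  rw [← L2.inner_indicatorConstLp_one (𝕜 := ℂ) hAm hA.ne, ← integral_inner hF,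
    integral_integral_swap (f := fun ω s => Φ (s, ω)) (hi A hA).swap]
  refine integral_congr_ae ?_
  filter_upwards [h] with s hs
  rw [L2.inner_indicatorConstLp_one (𝕜 := ℂ) hAm hA.ne]
  exact integral_congr_ae (ae_restrict_of_ae hs)

end BochnerLp

/-! ### Left and right convolution operators on a unimodular group -/

section GroupAlgebra

variable {G : Type*} [Group G] [TopologicalSpace G] [IsTopologicalGroup G]
  [LocallyCompactSpace G] [T2Space G] [SecondCountableTopology G] [MeasurableSpace G]
  [BorelSpace G] (ν : Measure G) [ν.IsHaarMeasure] [ν.IsMulRightInvariant]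

/-- The Haar measure of a unimodular group is invariant under inversion. -/
instance isInvInvariant_of_unimodular : ν.IsInvInvariant := by
  constructor
  let c : ℝ≥0∞ := Measure.haarScalarFactor ν.inv ν
  -- Right invariance of `ν` makes `ν.inv` left invariant, so uniqueness of Haar measure applies;
  -- inverting twice then forces `c² = 1`.
  have hc : ν.inv = c • ν := Measure.isMulLeftInvariant_eq_smul ν.inv ν
  have h2 : Measure.map Inv.inv (Measure.map Inv.inv ν) = c ^ 2 • ν := by
    rw [← Measure.inv_def ν, hc, Measure.map_smul, ← Measure.inv_def ν, hc, smul_smul, pow_two]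
  have hν : ν = c ^ 2 • ν := by
    rw [Measure.map_map continuous_inv.measurable continuous_inv.measurable] at h2
    simpa only [inv_involutive, Function.Involutive.comp_self, Measure.map_id] using h2
  have K : TopologicalSpace.PositiveCompacts G := Classical.arbitrary _
  have h3 : c ^ 2 * ν K = 1 ^ 2 * ν K := by
    conv_rhs => rw [hν]
    simp
  have h4 : c ^ 2 = 1 ^ 2 :=
    (ENNReal.mul_left_inj (Measure.measure_pos_of_nonempty_interior _ K.interior_nonempty).ne'
      K.isCompact.measure_lt_top.ne).1 h3
  have h5 : c = 1 := (ENNReal.pow_right_strictMono two_ne_zero).injective h4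
  rw [hc, h5, one_smul]

theorem measurePreserving_inv_mul (g : G) : MeasurePreserving (fun s => s⁻¹ * g) ν ν :=
  (measurePreserving_mul_right ν g).comp (Measure.measurePreserving_inv ν)

theorem groupConv_congr {f f' v v' : G → ℂ} (hf : f =ᵐ[ν] f') (hv : v =ᵐ[ν] v') :
    groupConv ν f v = groupConv ν f' v' := by
  funext g
  refine integral_congr_ae ?_
  filter_upwards [hf, (measurePreserving_inv_mul ν g).quasiMeasurePreserving.ae hv] with s h1 h2
  rw [h1, h2]

/-- For `L²` vectors convolution is defined at every point, and continuous in the second factor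
there, because it is an inner product with an isometric image of that factor. -/
theorem groupConv_eq_inner (ξ v : Lp ℂ 2 ν) (g : G) :
    groupConv ν ξ v g =
      inner ℂ (star ξ) (Lp.compMeasurePreserving _ (measurePreserving_inv_mul ν g) v) := by
  rw [L2.inner_def]
  refine integral_congr_ae ?_
  filter_upwards [Lp.coeFn_star ξ,
    Lp.coeFn_compMeasurePreserving v (measurePreserving_inv_mul ν g)] with s h1 h2
  rw [h1, h2]
  simp [mul_comm]

theorem continuous_groupConv_right (ξ : Lp ℂ 2 ν) (g : G) :
    Continuous fun v : Lp ℂ 2 ν => groupConv ν ξ v g := by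
  simp only [groupConv_eq_inner]
  exact continuous_const.inner
    (Lp.isometry_compMeasurePreserving (measurePreserving_inv_mul ν g)).continuous

theorem stronglyMeasurable_groupConv_kernel {f v : G → ℂ} (hf : StronglyMeasurable f)
    (hv : StronglyMeasurable v) :
    StronglyMeasurable fun p : G × G => f p.1 * v (p.1⁻¹ * p.2) :=
  (hf.comp_measurable measurable_fst).mul (hv.comp_measurable (by fun_prop))

theorem coeFn_lambdaOp (f : C_c(G, ℂ)) (v : Lp ℂ 2 ν) :
    lambdaOp ν f v =ᵐ[ν] groupConv ν f v := by
  rw [lambdaOp_apply]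
  refine coeFn_integral_Lp (integrable_smul_leftReg ν f v)
    (stronglyMeasurable_groupConv_kernel f.continuous.stronglyMeasurable
      (Lp.stronglyMeasurable v)) (Filter.Eventually.of_forall fun s => ?_)
  filter_upwards [Lp.coeFn_smul (f s) (leftReg ν s v),
    Lp.coeFn_compMeasurePreserving v (measurePreserving_mul_left ν s⁻¹)] with g h1 h2
  rw [h1, Pi.smul_apply, smul_eq_mul]
  exact congrArg _ h2

/-- The right regular representation, `(ρ_s η)(g) = η(g s)`. -/
def rightReg (s : G) : Lp ℂ 2 ν →L[ℂ] Lp ℂ 2 ν :=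
  (Lp.compMeasurePreservingₗᵢ ℂ (fun g => g * s)
    (measurePreserving_mul_right ν s)).toContinuousLinearMap

theorem norm_rightReg_apply (s : G) (η : Lp ℂ 2 ν) : ‖rightReg ν s η‖ = ‖η‖ :=
  Lp.norm_compMeasurePreserving η _

theorem continuous_rightReg_apply (η : Lp ℂ 2 ν) : Continuous fun s => rightReg ν s η := by
  let φ : G → C(G, G) := fun s => ⟨fun g => g * s, by fun_prop⟩
  have hφ : Continuous φ :=
    (ContinuousMap.curry ⟨fun p : G × G => p.2 * p.1, by fun_prop⟩).continuous
  exact (continuous_const (y := η)).compMeasurePreservingLp hφ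
    (fun s => measurePreserving_mul_right ν s) (by simp)

theorem integrable_smul_rightReg (f : C_c(G, ℂ)) (η : Lp ℂ 2 ν) :
    Integrable (fun s => f s⁻¹ • rightReg ν s η) ν := by
  have h : Integrable (fun s => f s • rightReg ν s⁻¹ η) ν := by
    refine Continuous.integrable_of_hasCompactSupport ?_ ?_
    · exact f.continuous.smul ((continuous_rightReg_apply ν η).comp continuous_inv)
    · exact f.hasCompactSupport.smul_right
  simpa using h.comp_inv

/-- Right convolution by a compactly supported function. -/
def rightConvOp (f : C_c(G, ℂ)) : Lp ℂ 2 ν →L[ℂ] Lp ℂ 2 ν :=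
  LinearMap.mkContinuous
    { toFun := fun η => ∫ s, f s⁻¹ • rightReg ν s η ∂ν
      map_add' := fun η ζ => by
        simp only [map_add, smul_add]
        exact integral_add (integrable_smul_rightReg ν f η) (integrable_smul_rightReg ν f ζ)
      map_smul' := fun c η => by
        simp only [map_smul, RingHom.id_apply]
        rw [← integral_smul]
        simp only [smul_comm c] }
    (∫ s, ‖f s⁻¹‖ ∂ν)
    (fun η => by
      refine (norm_integral_le_integral_norm _).trans (le_of_eq ?_)
      rw [← integral_mul_const]
      simp only [norm_smul, norm_rightReg_apply])

theorem rightConvOp_apply (f : C_c(G, ℂ)) (η : Lp ℂ 2 ν) :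
    rightConvOp ν f η = ∫ s, f s⁻¹ • rightReg ν s η ∂ν := rfl

theorem coeFn_rightConvOp (f : C_c(G, ℂ)) (v : Lp ℂ 2 ν) :
    rightConvOp ν f v =ᵐ[ν] groupConv ν v f := by
  have h : (fun g => ∫ s, f s⁻¹ * v (g * s) ∂ν) = groupConv ν v f := by
    funext g
    rw [groupConv, ← integral_mul_left_eq_self (fun t => v t * f (t⁻¹ * g)) g]
    refine integral_congr_ae (Filter.Eventually.of_forall fun s => ?_)
    simp [mul_comm]
  rw [rightConvOp_apply, ← h]
  refine coeFn_integral_Lp (Φ := fun p : G × G => f p.1⁻¹ * v (p.2 * p.1))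
    (integrable_smul_rightReg ν f v) ?_ (Filter.Eventually.of_forall fun s => ?_)
  · exact (f.continuous.stronglyMeasurable.comp_measurable (by fun_prop)).mul
      ((Lp.stronglyMeasurable v).comp_measurable (by fun_prop))
  · filter_upwards [Lp.coeFn_smul (f s⁻¹) (rightReg ν s v),
      Lp.coeFn_compMeasurePreserving v (measurePreserving_mul_right ν s)] with g h1 h2
    rw [h1, Pi.smul_apply, smul_eq_mul]
    exact congrArg _ h2

theorem leftReg_rightReg (g s : G) (v : Lp ℂ 2 ν) :
    leftReg ν g (rightReg ν s v) = rightReg ν s (leftReg ν g v) := by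
  refine Lp.ext ?_
  filter_upwards [Lp.coeFn_compMeasurePreserving (rightReg ν s v) (measurePreserving_mul_left ν g⁻¹),
    Lp.coeFn_compMeasurePreserving (leftReg ν g v) (measurePreserving_mul_right ν s),
    (measurePreserving_mul_left ν g⁻¹).quasiMeasurePreserving.ae
      (Lp.coeFn_compMeasurePreserving v (measurePreserving_mul_right ν s)),
    (measurePreserving_mul_right ν s).quasiMeasurePreserving.ae
      (Lp.coeFn_compMeasurePreserving v (measurePreserving_mul_left ν g⁻¹))] with t h1 h2 h3 h4
  refine h1.trans (h3.trans ?_)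
  refine (h2.trans (h4.trans ?_)).symm
  simp [mul_assoc]

theorem leftReg_mul_rightConvOp (g : G) (f : C_c(G, ℂ)) :
    leftReg ν g * rightConvOp ν f = rightConvOp ν f * leftReg ν g := by
  ext1 v
  change leftReg ν g (rightConvOp ν f v) = rightConvOp ν f (leftReg ν g v)
  rw [rightConvOp_apply, rightConvOp_apply,
    ← ContinuousLinearMap.integral_comp_comm _ (integrable_smul_rightReg ν f v)]
  simp only [map_smul, leftReg_rightReg]

theorem adjoint_leftReg (g : G) : star (leftReg ν g) = leftReg ν g⁻¹ := by
  rw [ContinuousLinearMap.star_eq_adjoint]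
  symm
  rw [ContinuousLinearMap.eq_adjoint_iff]
  intro u v
  have h : leftReg ν g (leftReg ν g⁻¹ u) = u := by
    refine Lp.ext ?_
    filter_upwards [Lp.coeFn_compMeasurePreserving (leftReg ν g⁻¹ u)
      (measurePreserving_mul_left ν g⁻¹), (measurePreserving_mul_left ν g⁻¹).quasiMeasurePreserving.ae
      (Lp.coeFn_compMeasurePreserving u (measurePreserving_mul_left ν g⁻¹⁻¹))] with t h1 h2
    refine h1.trans (h2.trans ?_)
    simp
  have h2 := (Lp.compMeasurePreservingₗᵢ ℂ (fun s => g⁻¹ * s)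
    (measurePreserving_mul_left ν g⁻¹) (E := ℂ) (p := 2)).inner_map_map (leftReg ν g⁻¹ u) v
  rw [← h2]
  exact congrArg (fun w => inner ℂ w (leftReg ν g v)) h

/-- Right convolutions lie in the commutant of `λ(G)`, and `L(G)` is the double commutant. -/
theorem rightConvOp_commute {x : Lp ℂ 2 ν →L[ℂ] Lp ℂ 2 ν} (hx : x ∈ (groupVN ν).toStarSubalgebra)
    (f : C_c(G, ℂ)) : Commute x (rightConvOp ν f) := by
  change x ∈ StarSubalgebra.centralizer ℂ
    (StarSubalgebra.centralizer ℂ (Set.range (leftReg ν)) : Set (Lp ℂ 2 ν →L[ℂ] Lp ℂ 2 ν)) at hx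
  rw [StarSubalgebra.mem_centralizer_iff] at hx
  refine ((hx _ ?_).1).symm
  rw [SetLike.mem_coe, StarSubalgebra.mem_centralizer_iff]
  rintro _ ⟨g, rfl⟩
  exact ⟨leftReg_mul_rightConvOp ν g f, by
    rw [adjoint_leftReg]; exact leftReg_mul_rightConvOp ν g⁻¹ f⟩

/-- A compactly supported continuous function as a vector of `L²(G)`. -/
def coreLp (f : C_c(G, ℂ)) : Lp ℂ 2 ν :=
  (f.continuous.memLp_of_hasCompactSupport f.hasCompactSupport : MemLp f 2 ν).toLp _

theorem coeFn_coreLp (f : C_c(G, ℂ)) : coreLp ν f =ᵐ[ν] f := MemLp.coeFn_toLp _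

theorem exists_tendsto_coreLp (v : Lp ℂ 2 ν) :
    ∃ f : ℕ → C_c(G, ℂ), Filter.Tendsto (fun n => coreLp ν (f n)) Filter.atTop (nhds v) := by
  have h : v ∈ closure (Set.range (coreLp ν)) := by
    rw [Metric.mem_closure_iff]
    intro ε hε
    obtain ⟨g, h1, h2, h3, h4⟩ := (Lp.memLp v).exists_hasCompactSupport_eLpNorm_sub_le
      (by norm_num) (ε := ENNReal.ofReal (ε / 2)) (by simpa using hε)
    refine ⟨_, ⟨⟨⟨g, h3⟩, h1⟩, rfl⟩, ?_⟩
    rw [Lp.dist_def]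
    have h5 : eLpNorm (⇑v - ⇑(coreLp ν ⟨⟨g, h3⟩, h1⟩)) 2 ν = eLpNorm (⇑v - g) 2 ν :=
      eLpNorm_congr_ae (Filter.EventuallyEq.rfl.sub (coeFn_coreLp ν _))
    rw [h5]
    have h6 := ENNReal.toReal_mono (by simp) h2
    rw [ENNReal.toReal_ofReal (by positivity)] at h6
    linarith
  obtain ⟨x, hx, hx'⟩ := mem_closure_iff_seq_limit.1 h
  choose f hf using hx
  exact ⟨f, by simpa [hf] using hx'⟩

/-- An operator which is left convolution by `ξ` on `C_c(G)` is so on `L²(G)`. -/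
theorem coeFn_eq_groupConv_of_core {ξ : Lp ℂ 2 ν} {S : Lp ℂ 2 ν →L[ℂ] Lp ℂ 2 ν}
    (h : ∀ f : C_c(G, ℂ), S (coreLp ν f) =ᵐ[ν] groupConv ν ξ (coreLp ν f)) (v : Lp ℂ 2 ν) :
    S v =ᵐ[ν] groupConv ν ξ v := by
  obtain ⟨f, hf⟩ := exists_tendsto_coreLp ν v
  have h1 : Filter.Tendsto (fun n => S (coreLp ν (f n))) Filter.atTop (nhds (S v)) :=
    (S.continuous.tendsto v).comp hf
  -- Norm convergence gives almost everywhere convergence only along a subsequence, but the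
  -- convolutions converge at every point, so the limits can be compared.
  obtain ⟨φ, hφ, h2⟩ := (tendstoInMeasure_of_tendsto_Lp h1).exists_seq_tendsto_ae
  have h3 : ∀ᵐ g ∂ν, ∀ n, S (coreLp ν (f n)) g = groupConv ν ξ (coreLp ν (f n)) g :=
    ae_all_iff.2 fun n => h (f n)
  filter_upwards [h2, h3] with g h4 h5
  refine tendsto_nhds_unique h4 ?_
  simp only [h5]
  exact ((continuous_groupConv_right ν ξ g).tendsto v).comp (hf.comp hφ.tendsto_atTop)

theorem eLpNorm_le_opNorm {Ω : Type*} [MeasurableSpace Ω] {m : Measure Ω}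
    (S : Lp ℂ 2 m →L[ℂ] Lp ℂ 2 m) (v : Lp ℂ 2 m) {w : Ω → ℂ} (h : S v =ᵐ[m] w) :
    eLpNorm w 2 m ≤ (‖S‖₊ : ℝ≥0∞) * ‖v‖ₑ := by
  rw [← eLpNorm_congr_ae h, ← Lp.enorm_def]
  exact S.le_opENorm v

/-- Right convolution by `f` is a bounded operator on all of `L²(G)`. Hence there are enough right
bounded vectors for `π_l(ξ)` to be determined by its action on the core. -/
theorem coreLp_mem_rightBounded (f : C_c(G, ℂ)) :
    coreLp ν f ∈ rightBounded ν (groupConv ν) (groupCore ν) := by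
  refine ⟨‖rightConvOp ν f‖₊, fun ξ _ => ?_⟩
  refine eLpNorm_le_opNorm _ _ ?_
  rw [groupConv_congr ν (Filter.EventuallyEq.refl _ _) (coeFn_coreLp ν f)]
  exact coeFn_rightConvOp ν f ξ

/-- `S = π_l(ξ)` if and only if `S` is left convolution by `ξ` on all of `L²(G)`. -/
theorem isPiL_group_iff {ξ : Lp ℂ 2 ν} {S : Lp ℂ 2 ν →L[ℂ] Lp ℂ 2 ν} :
    IsPiL ν (groupConv ν) (groupCore ν) ξ S ↔ ∀ v : Lp ℂ 2 ν, S v =ᵐ[ν] groupConv ν ξ v := by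
  constructor
  · rintro ⟨-, h⟩
    exact coeFn_eq_groupConv_of_core ν fun f => h _ (coreLp_mem_rightBounded ν f)
  · intro h
    exact ⟨⟨‖S‖₊, fun v _ => eLpNorm_le_opNorm _ _ (h v)⟩, fun v _ => h v⟩

theorem isPiL_coreLp (f : C_c(G, ℂ)) :
    IsPiL ν (groupConv ν) (groupCore ν) (coreLp ν f) (lambdaOp ν f) := by
  rw [isPiL_group_iff]
  intro v
  rw [groupConv_congr ν (coeFn_coreLp ν f) (Filter.EventuallyEq.refl _ _)]
  exact coeFn_lambdaOp ν f v

end GroupAlgebra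

/-! ### Approximate units and weak limits -/

/-- Sequential Banach–Alaoglu in a separable Hilbert space, transported through the Riesz
isomorphism. -/
theorem exists_weak_limit {E : Type*} [NormedAddCommGroup E] [InnerProductSpace ℂ E]
    [CompleteSpace E] [TopologicalSpace.SeparableSpace E] {x : ℕ → E} {c : ℝ}
    (hx : ∀ n, ‖x n‖ ≤ c) :
    ∃ (ξ : E) (φ : ℕ → ℕ), ‖ξ‖ ≤ c ∧ StrictMono φ ∧
      ∀ v, Filter.Tendsto (fun n => inner ℂ (x (φ n)) v) Filter.atTop (nhds (inner ℂ ξ v)) := by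
  obtain ⟨l, hl, φ, hφ, hlim⟩ := (WeakDual.isSeqCompact_closedBall ℂ E 0 c)
    (x := fun n => StrongDual.toWeakDual (InnerProductSpace.toDual ℂ E (x n)))
    (fun n => by simpa using hx n)
  refine ⟨(InnerProductSpace.toDual ℂ E).symm (WeakDual.toStrongDual l), φ, ?_, hφ, fun v => ?_⟩
  · simpa using hl
  · have h := ((WeakDual.eval_continuous v).tendsto l).comp hlim
    rw [InnerProductSpace.toDual_symm_apply]
    exact h

section GroupTrace

variable {G : Type*} [Group G] [TopologicalSpace G] [IsTopologicalGroup G]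
  [LocallyCompactSpace G] [T2Space G] [SecondCountableTopology G] [MeasurableSpace G]
  [BorelSpace G] (ν : Measure G) [ν.IsHaarMeasure] [ν.IsMulRightInvariant]

instance secondCountableTopology_Lp : SecondCountableTopology (Lp ℂ 2 ν) :=
  have : Fact ((2 : ℝ≥0∞) ≠ ∞) := ⟨by norm_num⟩
  inferInstance

theorem exists_bump {g : G} {W : Set G} (hW : W ∈ nhds g) :
    ∃ f : C_c(G, ℂ), (∫ s, ‖f s‖ ∂ν = 1) ∧ (∫ s, f s ∂ν = 1) ∧ ∀ s, f s ≠ 0 → s ∈ W := by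
  obtain ⟨V, hVW, hV, hgV⟩ := mem_nhds_iff.1 hW
  obtain ⟨r, hr1, hr2, hr3, hr4⟩ := exists_continuousMap_one_of_isCompact_subset_isOpen
    (isCompact_singleton (x := g)) hV (by simpa using hgV)
  have hpos : 0 < ∫ s, r s ∂ν :=
    r.continuous.integral_pos_of_hasCompactSupport_nonneg_nonzero hr2 (fun s => (hr4 s).1)
      (x := g) (by simp [hr1 rfl])
  set I := ∫ s, r s ∂ν with hI
  let f : C_c(G, ℂ) := ⟨⟨fun s => ((I⁻¹ * r s : ℝ) : ℂ), by fun_prop⟩, by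
    refine HasCompactSupport.mono (f := r) hr2 fun s hs => ?_
    rw [Function.mem_support] at hs ⊢
    intro h
    exact hs (by simp [h])⟩
  have hf (s : G) : f s = ((I⁻¹ * r s : ℝ) : ℂ) := rfl
  have h1 : ∫ s, I⁻¹ * r s ∂ν = 1 := by
    rw [integral_const_mul, inv_mul_cancel₀ hpos.ne']
  refine ⟨f, ?_, ?_, fun s hs => ?_⟩
  · simp only [hf, Complex.norm_real]
    rw [← h1]
    refine integral_congr_ae (Filter.Eventually.of_forall fun s => ?_)
    exact Real.norm_of_nonneg (mul_nonneg (inv_nonneg.2 hpos.le) (hr4 s).1)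
  · simp only [hf]
    rw [integral_complex_ofReal, h1, Complex.ofReal_one]
  · refine hVW (hr3 (subset_tsupport _ ?_))
    rw [Function.mem_support]
    intro h
    exact hs (by simp [hf, h])

/-- There are functions in `C_c(G)` of integral `1` with `λ(fₙ) → λ_g` strongly. -/
theorem exists_tendsto_lambdaOp (g : G) :
    ∃ f : ℕ → C_c(G, ℂ), (∀ n, ∫ s, ‖f n s‖ ∂ν = 1) ∧ ∀ v : Lp ℂ 2 ν,
      Filter.Tendsto (fun n => lambdaOp ν (f n) v) Filter.atTop (nhds (leftReg ν g v)) := by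
  obtain ⟨W, hW⟩ := (nhds g).exists_antitone_basis
  choose f hf1 hf2 hf3 using fun n => exists_bump ν (hW.mem n)
  refine ⟨f, hf1, fun v => ?_⟩
  rw [Metric.tendsto_atTop]
  intro ε hε
  have hcont := (continuous_leftReg_apply ν v).tendsto g
  obtain ⟨N, -, hN⟩ := hW.1.mem_iff.1 (hcont (Metric.ball_mem_nhds _ (half_pos hε)))
  refine ⟨N, fun n hn => ?_⟩
  have hint : Integrable (fun s => f n s) ν :=
    (f n).continuous.integrable_of_hasCompactSupport (f n).hasCompactSupport
  have h1 : lambdaOp ν (f n) v - leftReg ν g v =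
      ∫ s, f n s • (leftReg ν s v - leftReg ν g v) ∂ν := by
    simp only [smul_sub]
    rw [integral_sub (integrable_smul_leftReg ν (f n) v) (hint.smul_const _), lambdaOp_apply,
      integral_smul_const, hf2 n, one_smul]
  rw [dist_eq_norm, h1]
  have h2 : ‖∫ s, f n s • (leftReg ν s v - leftReg ν g v) ∂ν‖ ≤ ∫ s, ‖f n s‖ * (ε / 2) ∂ν := by
    refine norm_integral_le_of_norm_le (hint.norm.mul_const _)
      (Filter.Eventually.of_forall fun s => ?_)
    rw [norm_smul]
    by_cases hs : f n s = 0
    · simp [hs]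
    · have h3 : s ∈ W N := hW.antitone hn (hf3 n s hs)
      have h4 := hN h3
      rw [Set.mem_preimage, Metric.mem_ball, dist_eq_norm] at h4
      gcongr
  rw [integral_mul_const, hf1 n, one_mul] at h2
  linarith

/-- Both sides are `f * f'`, with the operator role given to either factor. -/
theorem rightConvOp_coreLp (f f' : C_c(G, ℂ)) :
    rightConvOp ν f' (coreLp ν f) = lambdaOp ν f (coreLp ν f') := by
  refine Lp.ext ?_
  refine (coeFn_rightConvOp ν f' _).trans ?_
  refine Filter.EventuallyEq.trans (Filter.EventuallyEq.of_eq ?_) (coeFn_lambdaOp ν f _).symm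
  exact groupConv_congr ν (coeFn_coreLp ν f) (coeFn_coreLp ν f').symm

theorem leftReg_one (v : Lp ℂ 2 ν) : leftReg ν 1 v = v := by
  refine Lp.ext ?_
  filter_upwards [Lp.coeFn_compMeasurePreserving v (measurePreserving_mul_left ν (1 : G)⁻¹)]
    with t h
  refine h.trans ?_
  simp

/-- An operator commuting with right convolutions which is bounded on approximate units is left
convolution by a left bounded vector. -/
theorem exists_isPiL_of_bounded {y : Lp ℂ 2 ν →L[ℂ] Lp ℂ 2 ν}
    (hy : ∀ f : C_c(G, ℂ), Commute y (rightConvOp ν f)) {c : ℝ}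
    (hc : ∀ f : C_c(G, ℂ), ∫ s, ‖f s‖ ∂ν = 1 → ‖y (coreLp ν f)‖ ≤ c) :
    ∃ ξ : Lp ℂ 2 ν, ‖ξ‖ ≤ c ∧ IsPiL ν (groupConv ν) (groupCore ν) ξ y := by
  obtain ⟨f, hf1, hf2⟩ := exists_tendsto_lambdaOp ν (1 : G)
  obtain ⟨ξ, φ, hξ, hφ, hlim⟩ := exists_weak_limit (fun n => hc (f n) (hf1 n))
  refine ⟨ξ, hξ, (isPiL_group_iff ν).2 (coeFn_eq_groupConv_of_core ν fun k => ?_)⟩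
  -- Weakly, `ξ * k = lim y(fₙ) * k = lim y(fₙ * k) = y(k)`: the middle equality is the commutation
  -- hypothesis, the last one the approximate unit property.
  have h1 : rightConvOp ν k ξ = y (coreLp ν k) := by
    refine ext_inner_right ℂ fun v => ?_
    have h2 := hlim (ContinuousLinearMap.adjoint (rightConvOp ν k) v)
    simp only [ContinuousLinearMap.adjoint_inner_right] at h2
    have h3 (n : ℕ) : rightConvOp ν k (y (coreLp ν (f n))) = y (lambdaOp ν (f n) (coreLp ν k)) := by
      rw [← rightConvOp_coreLp]
      exact (congrArg (fun A : Lp ℂ 2 ν →L[ℂ] Lp ℂ 2 ν => A (coreLp ν (f n))) (hy k).eq).symm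
    simp only [h3] at h2
    refine tendsto_nhds_unique h2 ?_
    have h4 := (hf2 (coreLp ν k)).comp hφ.tendsto_atTop
    rw [leftReg_one] at h4
    exact (((y.continuous.tendsto _).comp h4).inner tendsto_const_nhds)
  rw [← h1, groupConv_congr ν (Filter.EventuallyEq.refl _ _) (coeFn_coreLp ν k)]
  exact coeFn_rightConvOp ν k ξ

end GroupTrace

/-! ### Unitaries induced by measure preserving equivalences -/

section CompEquiv

variable {Ω Ω' : Type*} [MeasurableSpace Ω] [MeasurableSpace Ω'] {m : Measure Ω} {m' : Measure Ω'}

/-- The unitary of composition with a measure preserving equivalence. -/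
def compEquiv (e : Ω ≃ᵐ Ω') (he : MeasurePreserving e m m') : Lp ℂ 2 m' ≃ₗᵢ[ℂ] Lp ℂ 2 m where
  toFun := Lp.compMeasurePreserving e he
  invFun := Lp.compMeasurePreserving e.symm (he.symm e)
  map_add' u v := map_add (Lp.compMeasurePreservingₗᵢ ℂ e he) u v
  map_smul' c u := map_smul (Lp.compMeasurePreservingₗᵢ ℂ e he) c u
  left_inv u := by
    refine Lp.ext ?_
    filter_upwards [Lp.coeFn_compMeasurePreserving (Lp.compMeasurePreserving e he u) (he.symm e),
      (he.symm e).quasiMeasurePreserving.ae (Lp.coeFn_compMeasurePreserving u he)] with ω h1 h2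
    rw [h1, Function.comp_apply, h2, Function.comp_apply, e.apply_symm_apply]
  right_inv u := by
    refine Lp.ext ?_
    filter_upwards [Lp.coeFn_compMeasurePreserving (Lp.compMeasurePreserving e.symm (he.symm e) u) he,
      he.quasiMeasurePreserving.ae (Lp.coeFn_compMeasurePreserving u (he.symm e))] with ω h1 h2
    rw [h1, Function.comp_apply, h2, Function.comp_apply, e.symm_apply_apply]
  norm_map' u := Lp.norm_compMeasurePreserving u he

theorem coeFn_compEquiv (e : Ω ≃ᵐ Ω') (he : MeasurePreserving e m m') (u : Lp ℂ 2 m') :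
    compEquiv e he u =ᵐ[m] fun ω => u (e ω) := Lp.coeFn_compMeasurePreserving u he

theorem coeFn_compEquiv_symm (e : Ω ≃ᵐ Ω') (he : MeasurePreserving e m m') (u : Lp ℂ 2 m) :
    (compEquiv e he).symm u =ᵐ[m'] fun ω => u (e.symm ω) :=
  Lp.coeFn_compMeasurePreserving u (he.symm e)

end CompEquiv

/-! ### The twisting change of variables and twisted convolutions -/

section Twist

variable {G H X : Type*} [Group G] [TopologicalSpace G] [IsTopologicalGroup G]
  [LocallyCompactSpace G] [T2Space G] [SecondCountableTopology G] [MeasurableSpace G]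
  [BorelSpace G] (ν : Measure G) [ν.IsHaarMeasure] [ν.IsMulRightInvariant]
  [Group H] [Countable H] [TopologicalSpace H] [DiscreteTopology H] [MeasurableSpace H]
  [BorelSpace H] [MeasurableSpace X] (μ : Measure X) [IsFiniteMeasure μ]

instance measurableMul₂_of_discrete : MeasurableMul₂ H := ⟨Measurable.of_discrete⟩

instance measurableInv_of_discrete : MeasurableInv H := ⟨Measurable.of_discrete⟩

/-- The change of variables `(h, g, x) ↦ (h⁻¹ β(g, x), x, g)`. -/
def twist (β : G × X → H) (hβ : Measurable β) : (H × G) × X ≃ᵐ (H × X) × G where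
  toFun p := ((p.1.1⁻¹ * β (p.1.2, p.2), p.2), p.1.2)
  invFun q := ((β (q.2, q.1.2) * q.1.1⁻¹, q.2), q.1.2)
  left_inv p := by simp
  right_inv q := by simp
  measurable_toFun := by
    change Measurable fun p : (H × G) × X => ((p.1.1⁻¹ * β (p.1.2, p.2), p.2), p.1.2)
    fun_prop
  measurable_invFun := by
    change Measurable fun q : (H × X) × G => ((β (q.2, q.1.2) * q.1.1⁻¹, q.2), q.1.2)
    fun_prop

theorem twist_apply (β : G × X → H) (hβ : Measurable β) (p : (H × G) × X) :
    twist β hβ p = ((p.1.1⁻¹ * β (p.1.2, p.2), p.2), p.1.2) := rfl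

variable (H) in
theorem measurePreserving_rotate :
    MeasurePreserving (fun p : (H × G) × X => ((p.1.2, p.2), p.1.1))
      (((Measure.count : Measure H).prod ν).prod μ) ((ν.prod μ).prod Measure.count) :=
  Measure.measurePreserving_swap.comp (measurePreserving_prodAssoc _ _ _)

variable (H) in
theorem measurePreserving_unrotate :
    MeasurePreserving (fun q : (G × X) × H => ((q.2, q.1.1), q.1.2))
      ((ν.prod μ).prod Measure.count) (((Measure.count : Measure H).prod ν).prod μ) :=
  ((measurePreserving_prodAssoc (Measure.count : Measure H) ν μ).symm _).comp
    Measure.measurePreserving_swap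

/-- A bundle map over a measure preserving transformation which is a right translation in the
discrete fibres is measure preserving. -/
theorem measurePreserving_skew {T : G × X → G × X} (hT : MeasurePreserving T (ν.prod μ) (ν.prod μ))
    {γ : G × X → H} (hγ : Measurable γ) :
    MeasurePreserving (fun p : (H × G) × X =>
        ((p.1.1 * γ (p.1.2, p.2), (T (p.1.2, p.2)).1), (T (p.1.2, p.2)).2))
      (((Measure.count : Measure H).prod ν).prod μ)
      (((Measure.count : Measure H).prod ν).prod μ) := by
  have h : MeasurePreserving (fun q : (G × X) × H => (T q.1, q.2 * γ q.1))
      ((ν.prod μ).prod Measure.count) ((ν.prod μ).prod Measure.count) :=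
    hT.skew_product (g := fun a h => h * γ a)
      (by change Measurable fun q : (G × X) × H => q.2 * γ q.1; fun_prop)
      (Filter.Eventually.of_forall fun a => (measurePreserving_mul_right _ (γ a)).map_eq)
  exact ((measurePreserving_unrotate H ν μ).comp h).comp (measurePreserving_rotate H ν μ)

theorem measurePreserving_twist (β : G × X → H) (hβ : Measurable β) :
    MeasurePreserving (twist β hβ) (((Measure.count : Measure H).prod ν).prod μ)
      (((Measure.count : Measure H).prod μ).prod ν) := by
  have h : MeasurePreserving (fun q : (G × X) × H => (q.1, q.2⁻¹ * β q.1))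
      ((ν.prod μ).prod Measure.count) ((ν.prod μ).prod Measure.count) :=
    (MeasurePreserving.id _).skew_product (g := fun a h => h⁻¹ * β a)
      (by change Measurable fun q : (G × X) × H => q.2⁻¹ * β q.1; fun_prop)
      (Filter.Eventually.of_forall fun a => ((measurePreserving_mul_right _ (β a)).comp
        (Measure.measurePreserving_inv _)).map_eq)
  have h2 : MeasurePreserving (fun q : (G × X) × H => ((q.2, q.1.2), q.1.1))
      ((ν.prod μ).prod Measure.count) (((Measure.count : Measure H).prod μ).prod ν) :=
    (((measurePreserving_prodAssoc (Measure.count : Measure H) μ ν).symm _).comp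
      Measure.measurePreserving_swap).comp
      (Measure.measurePreserving_swap.prod (MeasurePreserving.id _))
  exact (h2.comp h).comp (measurePreserving_rotate H ν μ)

/-- The unitary `L²((H × X) × G) → L²((H × G) × X)` of composition with `twist β`. -/
def twistEquiv (β : G × X → H) (hβ : Measurable β) :
    Lp ℂ 2 (((Measure.count : Measure H).prod μ).prod ν) ≃ₗᵢ[ℂ]
      Lp ℂ 2 (((Measure.count : Measure H).prod ν).prod μ) :=
  compEquiv (twist β hβ) (measurePreserving_twist ν μ β hβ)

theorem coeFn_twistEquiv (β : G × X → H) (hβ : Measurable β)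
    (u : Lp ℂ 2 (((Measure.count : Measure H).prod μ).prod ν)) :
    twistEquiv ν μ β hβ u =ᵐ[((Measure.count : Measure H).prod ν).prod μ]
      fun p => u (twist β hβ p) := coeFn_compEquiv _ _ _

theorem coeFn_twistEquiv_symm (β : G × X → H) (hβ : Measurable β)
    (u : Lp ℂ 2 (((Measure.count : Measure H).prod ν).prod μ)) :
    (twistEquiv ν μ β hβ).symm u =ᵐ[((Measure.count : Measure H).prod μ).prod ν]
      fun q => u ((twist β hβ).symm q) := coeFn_compEquiv_symm _ _ _

variable {μ} in
theorem coeFn_ampl_of_forall {S : Lp ℂ 2 ν →L[ℂ] Lp ℂ 2 ν}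
    {u : Lp ℂ 2 (((Measure.count : Measure H).prod μ).prod ν)} {Φ : (H × X) × G → ℂ}
    (hΦ : StronglyMeasurable Φ)
    (h : ∀ᵐ y ∂((Measure.count : Measure H).prod μ), ∀ v : Lp ℂ 2 ν,
      (v =ᵐ[ν] fun g => u (y, g)) → S v =ᵐ[ν] fun g => Φ (y, g)) :
    ampl ((Measure.count : Measure H).prod μ) S u =ᵐ[((Measure.count : Measure H).prod μ).prod ν]
      Φ := by
  have hm := (Lp.stronglyMeasurable (ampl ((Measure.count : Measure H).prod μ) S u)
    ).measurableSet_eq_fun hΦ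
  refine (Measure.ae_prod_iff_ae_ae hm).2 ?_
  filter_upwards [coeFn_ampl S u, h] with y ⟨v, h1, h2⟩ h3
  filter_upwards [h2, h3 v h1] with g e1 e2
  rw [← e1, e2]

/-- If `S` is left convolution by `ξ`, then the twisted amplification of `S` is a twisted
convolution. -/
theorem coeFn_twist_ampl {ξ : G → ℂ} (hξ : StronglyMeasurable ξ) {S : Lp ℂ 2 ν →L[ℂ] Lp ℂ 2 ν}
    (hS : ∀ v : Lp ℂ 2 ν, S v =ᵐ[ν] groupConv ν ξ v) {β β' : G × X → H} (hβ : Measurable β)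
    (hβ' : Measurable β') (η : Lp ℂ 2 (((Measure.count : Measure H).prod ν).prod μ))
    {η₀ : (H × G) × X → ℂ} (hη₀ : StronglyMeasurable η₀)
    (hη : η =ᵐ[((Measure.count : Measure H).prod ν).prod μ] η₀) :
    twistEquiv ν μ β hβ (ampl ((Measure.count : Measure H).prod μ) S
        ((twistEquiv ν μ β' hβ').symm η)) =ᵐ[((Measure.count : Measure H).prod ν).prod μ]
      fun p => ∫ s, ξ s * η₀ ((β' (s⁻¹ * p.1.2, p.2) * (p.1.1⁻¹ * β (p.1.2, p.2))⁻¹,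
        s⁻¹ * p.1.2), p.2) ∂ν := by
  set u := (twistEquiv ν μ β' hβ').symm η
  set u₀ : (H × X) × G → ℂ := fun q => η₀ ((twist β' hβ').symm q) with hu₀
  have hu₀m : StronglyMeasurable u₀ := hη₀.comp_measurable (twist β' hβ').symm.measurable
  have hu : u =ᵐ[((Measure.count : Measure H).prod μ).prod ν] u₀ :=
    (coeFn_twistEquiv_symm ν μ β' hβ' η).trans
      (((measurePreserving_twist ν μ β' hβ').symm _).quasiMeasurePreserving.ae_eq_comp hη)
  have hΦ : StronglyMeasurable fun q : (H × X) × G => ∫ s, ξ s * u₀ (q.1, s⁻¹ * q.2) ∂ν :=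
    StronglyMeasurable.integral_prod_right'
      (f := fun z : ((H × X) × G) × G => ξ z.2 * u₀ (z.1.1, z.2⁻¹ * z.1.2))
      ((hξ.comp_measurable measurable_snd).mul (hu₀m.comp_measurable
        (show Measurable fun z : ((H × X) × G) × G => (z.1.1, z.2⁻¹ * z.1.2) by fun_prop)))
  have key := coeFn_ampl_of_forall (S := S) (u := u) ν hΦ (by
    filter_upwards [Measure.ae_ae_of_ae_prod hu] with y hy v hv
    refine (hS v).trans (Filter.EventuallyEq.of_eq ?_)
    rw [groupConv_congr ν (Filter.EventuallyEq.refl _ ξ) (hv.trans hy)]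
    rfl)
  filter_upwards [coeFn_twistEquiv ν μ β hβ (ampl ((Measure.count : Measure H).prod μ) S u),
    (measurePreserving_twist ν μ β hβ).quasiMeasurePreserving.ae key] with p h1 h2
  rw [h1, h2]
  rfl

/-- Over each `s` the graph has a single point, of counting measure one. -/
theorem restrict_graph_eq_map {φ : G → H} (hφ : Measurable φ) :
    ((Measure.count : Measure H).prod ν).restrict {p | p.1 = φ p.2} =
      ν.map fun s => (φ s, s) := by
  have hg : MeasurableSet {p : H × G | p.1 = φ p.2} :=
    measurableSet_eq_fun measurable_fst (by fun_prop)
  ext t ht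
  rw [Measure.restrict_apply ht, Measure.prod_apply_symm (ht.inter hg),
    Measure.map_apply (by fun_prop) ht, ← lintegral_indicator_one (ht.preimage (by fun_prop))]
  refine lintegral_congr fun s => ?_
  by_cases hs : (φ s, s) ∈ t
  · have : (fun a : H => (a, s)) ⁻¹' (t ∩ {p | p.1 = φ p.2}) = {φ s} := by
      ext a
      simp only [Set.mem_preimage, Set.mem_inter_iff, Set.mem_ofPred_eq, Set.mem_singleton_iff]
      exact ⟨fun h => h.2, fun h => ⟨h ▸ hs, h⟩⟩
    rw [this, Measure.count_singleton, Set.indicator_of_mem (by exact hs), Pi.one_apply]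
  · have : (fun a : H => (a, s)) ⁻¹' (t ∩ {p | p.1 = φ p.2}) = ∅ := by
      ext a
      simp only [Set.mem_preimage, Set.mem_inter_iff, Set.mem_ofPred_eq, Set.mem_empty_iff_false,
        iff_false, not_and]
      rintro h rfl
      exact hs h
    rw [this, measure_empty, Set.indicator_of_notMem (by exact hs)]

theorem integral_graph {φ : G → H} (hφ : Measurable φ) {F : H × G → ℂ}
    (hF : ∀ p, p.1 ≠ φ p.2 → F p = 0) :
    ∫ p, F p ∂((Measure.count : Measure H).prod ν) = ∫ s, F (φ s, s) ∂ν := by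
  have hemb : MeasurableEmbedding fun s => (φ s, s) :=
    MeasurableEmbedding.of_measurable_inverse (g := Prod.snd) (by fun_prop)
      (by
        have : Set.range (fun s => (φ s, s)) = {p : H × G | p.1 = φ p.2} := by
          ext ⟨a, s⟩
          simp only [Set.mem_range, Prod.mk.injEq, Set.mem_ofPred_eq]
          exact ⟨by rintro ⟨_, rfl, rfl⟩; rfl, fun h => ⟨s, h.symm, rfl⟩⟩
        rw [this]
        exact measurableSet_eq_fun measurable_fst (by fun_prop)) measurable_snd fun _ => rfl
  rw [← setIntegral_eq_integral_of_forall_compl_eq_zero (s := {p : H × G | p.1 = φ p.2})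
    (fun p hp => hF p hp), restrict_graph_eq_map ν hφ, hemb.integral_map]

variable [MulAction G X] [MeasurableSMul₂ G X]

/-- A left factor supported on the graph `h = γ(g, x)` collapses the sum over `H` to a single term.
Both `ι₀(f)` and its slices with a frozen cocycle have this form, up to a cut-off. -/
theorem crossedConv_graph {γ : G × X → H} (hγ : Measurable γ) {Ξ : G × X → ℂ}
    {ξ : (H × G) × X → ℂ} (h1 : ∀ g x, ξ ((γ (g, x), g), x) = Ξ (g, x))
    (h2 : ∀ h g x, γ (g, x) ≠ h → ξ ((h, g), x) = 0) (η : (H × G) × X → ℂ) (p : (H × G) × X) :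
    crossedConv (prodAction G H X) ((Measure.count : Measure H).prod ν) ξ η p =
      ∫ s, Ξ (s, s⁻¹ • p.1.2 • p.2) *
        η (((γ (s, s⁻¹ • p.1.2 • p.2))⁻¹ * p.1.1, s⁻¹ * p.1.2), p.2) ∂ν := by
  obtain ⟨⟨h, g⟩, x⟩ := p
  have hm : Measurable fun s : G => h⁻¹ * γ (g * s, s⁻¹ • x) := by fun_prop
  -- Left translation by `g` matches the variable `s` of a convolution over `G` with the variable `g
  -- s` in the crossed product.
  rw [← integral_mul_left_eq_self _ g]
  refine (integral_graph ν hm ?_).trans ?_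
  · rintro ⟨a, s⟩ ha
    refine mul_eq_zero_of_left (h2 _ _ _ fun h' => ha ?_) _
    change γ (g * s, s⁻¹ • x) = h * a at h'
    simp [h']
  · refine integral_congr_ae (Filter.Eventually.of_forall fun s => ?_)
    change ξ ((h * (h⁻¹ * γ (g * s, s⁻¹ • x)), g * s), s⁻¹ • x) *
      η (((h⁻¹ * γ (g * s, s⁻¹ • x))⁻¹, s⁻¹), x) = _
    simp only [mul_inv_cancel_left, h1, mul_inv_rev, inv_inv, mul_smul, inv_smul_smul,
      inv_mul_cancel_right]

theorem crossedConv_iotaZero_right {α : G × X → H} (hα : Measurable α) (f : G → ℂ)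
    (ζ : (H × G) × X → ℂ) (p : (H × G) × X) :
    crossedConv (prodAction G H X) ((Measure.count : Measure H).prod ν) ζ (iotaZero α f) p =
      ∫ s, ζ ((p.1.1 * (α (s⁻¹, p.2))⁻¹, p.1.2 * s), s⁻¹ • p.2) * f s⁻¹ ∂ν := by
  obtain ⟨⟨h, g⟩, x⟩ := p
  have hm : Measurable fun s : G => (α (s⁻¹, x))⁻¹ := by fun_prop
  refine (integral_graph ν hm ?_).trans ?_
  · rintro ⟨a, s⟩ ha
    refine mul_eq_zero_of_right _ (if_neg fun h' => ha ?_)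
    change α (s⁻¹, x) = a⁻¹ at h'
    simp [h']
  · refine integral_congr_ae (Filter.Eventually.of_forall fun s => ?_)
    change ζ ((h * (α (s⁻¹, x))⁻¹, g * s), s⁻¹ • x) * iotaZero α f (((α (s⁻¹, x))⁻¹⁻¹, s⁻¹), x) = _
    simp [iotaZero]

variable [SMulInvariantMeasure G X μ]

/-- For each fixed `s` the substitution in the first factor preserves the measure, by right
invariance on `H × G` and invariance of `μ`. In the second factor `x` is only a parameter. -/
theorem crossedConv_congr {ξ ξ' η η' : (H × G) × X → ℂ}
    (hξ : ξ =ᵐ[((Measure.count : Measure H).prod ν).prod μ] ξ')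
    (hη : η =ᵐ[((Measure.count : Measure H).prod ν).prod μ] η') :
    crossedConv (prodAction G H X) ((Measure.count : Measure H).prod ν) ξ η
      =ᵐ[((Measure.count : Measure H).prod ν).prod μ]
    crossedConv (prodAction G H X) ((Measure.count : Measure H).prod ν) ξ' η' := by
  have hq : Measure.QuasiMeasurePreserving
      (fun q : ((H × G) × X) × (H × G) => (q.1.1 * q.2, q.2.2⁻¹ • q.1.2))
      ((((Measure.count : Measure H).prod ν).prod μ).prod ((Measure.count : Measure H).prod ν))
      (((Measure.count : Measure H).prod ν).prod μ) := by
    refine QuasiMeasurePreserving.prod_of_left (by fun_prop)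
      (Filter.Eventually.of_forall fun s => ?_)
    exact ((measurePreserving_mul_right ((Measure.count : Measure H).prod ν) s).prod
      (measurePreserving_smul s.2⁻¹ μ)).quasiMeasurePreserving
  have h1 := Measure.ae_ae_of_ae_prod (hq.ae hξ)
  have h2 : ∀ᵐ x ∂μ, ∀ᵐ k ∂((Measure.count : Measure H).prod ν), η (k, x) = η' (k, x) :=
    Measure.ae_ae_of_ae_prod (Measure.measurePreserving_swap.quasiMeasurePreserving.ae hη)
  have hinv : Measure.QuasiMeasurePreserving (fun s : H × G => s⁻¹)
      ((Measure.count : Measure H).prod ν) ((Measure.count : Measure H).prod ν) :=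
    ((Measure.measurePreserving_inv Measure.count).prod
      (Measure.measurePreserving_inv ν)).quasiMeasurePreserving
  filter_upwards [h1, Measure.quasiMeasurePreserving_snd.ae h2] with p e1 e2
  refine integral_congr_ae ?_
  filter_upwards [e1, hinv.ae e2] with s e3 e4
  rw [e4]
  exact congrArg (· * _) e3

end Twist

/-! ### Minkowski's integral inequality -/

section Minkowski

variable {S Ω : Type*} [MeasurableSpace S] [MeasurableSpace Ω] {σ : Measure S} {m : Measure Ω}

theorem eLpNorm_two_sq {E : Type*} [NormedAddCommGroup E] (f : Ω → E) :
    eLpNorm f 2 m ^ 2 = ∫⁻ ω, ‖f ω‖ₑ ^ 2 ∂m := by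
  have h := eLpNorm_nnreal_pow_eq_lintegral (μ := m) (f := f) (p := 2) two_ne_zero
  simpa using h

/-- Cauchy–Schwarz for the weight `w`, splitting `F w = w^{1/2} · F w^{1/2}`. -/
theorem lintegral_mul_sq_le {w F : S → ℝ≥0∞} (hw : Measurable w) (hF : Measurable F) :
    (∫⁻ s, F s * w s ∂σ) ^ 2 ≤ (∫⁻ s, w s ∂σ) * ∫⁻ s, F s ^ 2 * w s ∂σ := by
  have hq : (2 : ℝ).HolderConjugate 2 := .two_two
  have h := ENNReal.lintegral_mul_le_Lp_mul_Lq σ hq (f := fun s => w s ^ (1 / 2 : ℝ))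
    (g := fun s => F s * w s ^ (1 / 2 : ℝ)) (hw.pow_const _).aemeasurable
    (hF.mul (hw.pow_const _)).aemeasurable
  have hsq (a : ℝ≥0∞) : (a ^ (1 / 2 : ℝ)) ^ (2 : ℝ) = a := by
    rw [← ENNReal.rpow_mul]; norm_num
  have e1 : (fun s => w s ^ (1 / 2 : ℝ)) * (fun s => F s * w s ^ (1 / 2 : ℝ)) =
      fun s => F s * w s := by
    funext s
    rw [Pi.mul_apply, mul_left_comm, ← ENNReal.rpow_add_of_nonneg _ _ (by norm_num) (by norm_num)]
    norm_num
  rw [e1] at h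
  simp only [ENNReal.mul_rpow_of_nonneg _ _ (zero_le_two : (0 : ℝ) ≤ 2), hsq] at h
  have h2 := pow_le_pow_left₀ (zero_le) h 2
  rw [mul_pow, ← ENNReal.rpow_natCast, ← ENNReal.rpow_natCast, ← ENNReal.rpow_natCast] at h2
  rw [← ENNReal.rpow_natCast]
  simp only [Nat.cast_ofNat, hsq, ENNReal.rpow_two] at h2 ⊢
  exact h2

variable [SFinite σ] [SFinite m]

/-- Minkowski's integral inequality in `L²`. -/
theorem eLpNorm_integral_mul_le {Φ : S × Ω → ℂ} (hΦ : Measurable Φ) {f : S → ℂ}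
    (hf : Measurable f) {N : ℝ≥0∞} (h : ∀ s, ∫⁻ ω, ‖Φ (s, ω)‖ₑ ^ 2 ∂m ≤ N ^ 2) :
    eLpNorm (fun ω => ∫ s, Φ (s, ω) * f s ∂σ) 2 m ≤ (∫⁻ s, ‖f s‖ₑ ∂σ) * N := by
  rw [← ENNReal.pow_le_pow_left_iff two_ne_zero, eLpNorm_two_sq, mul_pow]
  have hΦω (ω : Ω) : Measurable fun s => ‖Φ (s, ω)‖ₑ :=
    (hΦ.comp measurable_prodMk_right).enorm
  have h1 (ω : Ω) : ‖∫ s, Φ (s, ω) * f s ∂σ‖ₑ ^ 2 ≤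
      (∫⁻ s, ‖f s‖ₑ ∂σ) * ∫⁻ s, ‖Φ (s, ω)‖ₑ ^ 2 * ‖f s‖ₑ ∂σ := by
    refine le_trans (pow_le_pow_left₀ (zero_le) (enorm_integral_le_lintegral_enorm _) 2) ?_
    simp only [enorm_mul]
    exact lintegral_mul_sq_le hf.enorm (hΦω ω)
  have hmeas : Measurable fun p : S × Ω => ‖Φ p‖ₑ ^ 2 * ‖f p.1‖ₑ :=
    (hΦ.enorm.pow_const _).mul (hf.comp measurable_fst).enorm
  refine (lintegral_mono h1).trans ?_
  rw [lintegral_const_mul _ (Measurable.lintegral_prod_left' hmeas), pow_two (∫⁻ s, ‖f s‖ₑ ∂σ),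
    mul_assoc]
  refine mul_le_mul' le_rfl ?_
  rw [lintegral_lintegral_swap (f := fun ω s => ‖Φ (s, ω)‖ₑ ^ 2 * ‖f s‖ₑ)
    (hmeas.comp measurable_swap).aemeasurable, ← lintegral_mul_const _ hf.enorm]
  refine lintegral_mono fun s => ?_
  have hs : Measurable fun ω => ‖Φ (s, ω)‖ₑ ^ 2 :=
    (hΦ.comp measurable_prodMk_left).enorm.pow_const 2
  rw [lintegral_mul_const _ hs, mul_comm]
  exact mul_le_mul' le_rfl (h s)

end Minkowski

/-! ### Cutting down to measurable sets -/

section RestrictOp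

variable {Ω : Type*} [MeasurableSpace Ω] {m : Measure Ω}

/-- Multiplication by the indicator function of a measurable set on `L²`. -/
def restrictOp {B : Set Ω} (hB : MeasurableSet B) : Lp ℂ 2 m →L[ℂ] Lp ℂ 2 m :=
  LinearMap.mkContinuous
    { toFun := fun u => ((Lp.memLp u).indicator hB).toLp _
      map_add' := fun u v => by
        refine Lp.ext ?_
        filter_upwards [((Lp.memLp (u + v)).indicator hB).coeFn_toLp,
          ((Lp.memLp u).indicator hB).coeFn_toLp, ((Lp.memLp v).indicator hB).coeFn_toLp,
          Lp.coeFn_add (((Lp.memLp u).indicator hB).toLp _) (((Lp.memLp v).indicator hB).toLp _),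
          Lp.coeFn_add u v] with ω h1 h2 h3 h4 h5
        rw [h1, h4, Pi.add_apply, h2, h3]
        by_cases hω : ω ∈ B
        · rw [Set.indicator_of_mem hω, h5]
          simp [hω]
        · simp [hω]
      map_smul' := fun c u => by
        refine Lp.ext ?_
        filter_upwards [((Lp.memLp (c • u)).indicator hB).coeFn_toLp,
          ((Lp.memLp u).indicator hB).coeFn_toLp,
          Lp.coeFn_smul c (((Lp.memLp u).indicator hB).toLp _),
          Lp.coeFn_smul c u] with ω h1 h2 h4 h5
        simp only [RingHom.id_apply]
        rw [h1, h4, Pi.smul_apply, h2]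
        by_cases hω : ω ∈ B
        · rw [Set.indicator_of_mem hω, h5]
          simp [hω]
        · simp [hω] }
    1 fun u => by
      rw [one_mul]
      refine Lp.norm_le_norm_of_ae_le ?_
      filter_upwards [((Lp.memLp u).indicator hB).coeFn_toLp] with ω h1
      refine (congrArg norm h1).trans_le ?_
      exact norm_indicator_le_norm_self _ _

theorem coeFn_restrictOp {B : Set Ω} (hB : MeasurableSet B) (u : Lp ℂ 2 m) :
    restrictOp hB u =ᵐ[m] B.indicator u :=
  ((Lp.memLp u).indicator hB).coeFn_toLp

/-- Restriction to increasing sets with full union converges strongly to the identity. -/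
theorem tendsto_restrictOp {H : Type*} [Countable H] {φ : Ω → H} {B : Finset H → Set Ω}
    (hBφ : ∀ F ω, ω ∈ B F ↔ φ ω ∈ F) (hB : ∀ F, MeasurableSet (B F)) (u : Lp ℂ 2 m) :
    Filter.Tendsto (fun F => restrictOp (hB F) u) Filter.atTop (nhds u) := by
  rw [Lp.tendsto_Lp_iff_tendsto_eLpNorm']
  have h1 (F : Finset H) : eLpNorm (⇑(restrictOp (hB F) u) - ⇑u) 2 m ^ 2 =
      ∫⁻ ω, ‖(B F)ᶜ.indicator u ω‖ₑ ^ 2 ∂m := by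
    rw [eLpNorm_two_sq]
    refine lintegral_congr_ae ?_
    filter_upwards [coeFn_restrictOp (hB F) u] with ω hω
    rw [Pi.sub_apply, hω]
    by_cases h : ω ∈ B F <;> simp [h]
  have h2 : Filter.Tendsto (fun F => eLpNorm (⇑(restrictOp (hB F) u) - ⇑u) 2 m ^ 2)
      Filter.atTop (nhds 0) := by
    simp only [h1]
    -- Dominated convergence is available along `Finset H` because `H` is countable, so that `atTop`
    -- is countably generated.
    have h3 := tendsto_lintegral_filter_of_dominated_convergence (μ := m)
      (l := (Filter.atTop : Filter (Finset H)))
      (F := fun F ω => ‖(B F)ᶜ.indicator u ω‖ₑ ^ 2) (f := fun _ => 0) (fun ω => ‖u ω‖ₑ ^ 2)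
      (Filter.Eventually.of_forall fun F => (((Lp.stronglyMeasurable u).measurable.indicator
        (hB F).compl).enorm.pow_const 2))
      (Filter.Eventually.of_forall fun F => Filter.Eventually.of_forall fun ω => by
        by_cases h : ω ∈ B F <;> simp [h])
      (by rw [← eLpNorm_two_sq]; exact ENNReal.pow_ne_top (Lp.memLp u).2.ne)
      (Filter.Eventually.of_forall fun ω => by
        refine tendsto_const_nhds.congr' ?_
        filter_upwards [Filter.eventually_ge_atTop {φ ω}] with F hF
        have : ω ∈ B F := (hBφ F ω).2 (hF (Finset.mem_singleton_self _))
        simp [this])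
    simpa using h3
  have h4 := h2.ennrpow_const (1 / 2)
  have h5 (a : ℝ≥0∞) : (a ^ 2) ^ (1 / 2 : ℝ) = a := by
    rw [← ENNReal.rpow_natCast, ← ENNReal.rpow_mul]; norm_num
  simp only [h5] at h4
  simpa using h4

end RestrictOp

/-! ### The twisted amplification and its action on vectors -/

section Iota

variable {G H X : Type*} [Group G] [TopologicalSpace G] [IsTopologicalGroup G]
  [LocallyCompactSpace G] [T2Space G] [SecondCountableTopology G] [MeasurableSpace G]
  [BorelSpace G] (ν : Measure G) [ν.IsHaarMeasure] [ν.IsMulRightInvariant]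
  [Group H] [Countable H] [TopologicalSpace H] [DiscreteTopology H] [MeasurableSpace H]
  [BorelSpace H] [MeasurableSpace X] (μ : Measure X) [IsFiniteMeasure μ]

theorem isPiL_of_forall {Ω : Type*} [MeasurableSpace Ω] {m : Measure Ω}
    {mul : (Ω → ℂ) → (Ω → ℂ) → Ω → ℂ} {A : Set (Lp ℂ 2 m)} {ξ : Lp ℂ 2 m}
    {T : Lp ℂ 2 m →L[ℂ] Lp ℂ 2 m} (h : ∀ η : Lp ℂ 2 m, T η =ᵐ[m] mul ξ η) : IsPiL m mul A ξ T :=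
  ⟨⟨‖T‖₊, fun v _ => eLpNorm_le_opNorm _ _ (h v)⟩, fun v _ => h v⟩

variable (H) in
theorem measure_unitFiber :
    ((Measure.count : Measure H).prod μ) ({1} ×ˢ Set.univ) = μ Set.univ := by
  rw [Measure.prod_prod, Measure.count_singleton, one_mul]

variable (H) in
/-- The indicator function of `{1} × X`. -/
def unitFiber : Lp ℂ 2 ((Measure.count : Measure H).prod μ) :=
  indicatorConstLp 2 (s := ({1} : Set H) ×ˢ (Set.univ : Set X))
    ((measurableSet_singleton 1).prod MeasurableSet.univ)
    (by rw [measure_unitFiber]; exact measure_ne_top _ _) 1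

/-- The source of the normalization of the trace: `iotaLp` is a unitary applied to `1_{ {1} × X } ⊗
ξ`, so it multiplies squared norms by `μ(X)`. -/
theorem enorm_unitFiber_sq : ‖unitFiber H μ‖ₑ ^ 2 = μ Set.univ := by
  rw [Lp.enorm_def, eLpNorm_two_sq]
  have h : ∀ᵐ y ∂((Measure.count : Measure H).prod μ), ‖unitFiber H μ y‖ₑ ^ 2 =
      (({1} : Set H) ×ˢ (Set.univ : Set X)).indicator 1 y := by
    filter_upwards [indicatorConstLp_coeFn (p := 2) (s := ({1} : Set H) ×ˢ (Set.univ : Set X))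
      (hs := (measurableSet_singleton 1).prod MeasurableSet.univ)
      (hμs := by rw [measure_unitFiber]; exact measure_ne_top μ _) (c := (1 : ℂ))] with y hy
    rw [unitFiber, hy]
    by_cases h : y ∈ ({1} : Set H) ×ˢ (Set.univ : Set X)
    · rw [Set.indicator_of_mem h, Set.indicator_of_mem h]; simp
    · rw [Set.indicator_of_notMem h, Set.indicator_of_notMem h]; simp
  rw [lintegral_congr_ae h, lintegral_indicator_one
    ((measurableSet_singleton 1).prod MeasurableSet.univ), measure_unitFiber]

/-- The extension of `ι₀` to `L²(G)`. -/
def iotaLp (γ : G × X → H) (hγ : Measurable γ) (ξ : Lp ℂ 2 ν) :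
    Lp ℂ 2 (((Measure.count : Measure H).prod ν).prod μ) :=
  twistEquiv ν μ γ hγ (tensorLp (unitFiber H μ) ξ)

theorem coeFn_iotaLp (γ : G × X → H) (hγ : Measurable γ) {ξ : Lp ℂ 2 ν} {ξ₀ : G → ℂ}
    (hξ : ξ =ᵐ[ν] ξ₀) :
    iotaLp ν μ γ hγ ξ =ᵐ[((Measure.count : Measure H).prod ν).prod μ] iotaZero γ ξ₀ := by
  have hmp := (measurePreserving_twist ν μ γ hγ).quasiMeasurePreserving
  filter_upwards [coeFn_twistEquiv ν μ γ hγ (tensorLp (unitFiber H μ) ξ),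
    hmp.ae (coeFn_tensorLp (unitFiber H μ) ξ),
    hmp.ae (Measure.quasiMeasurePreserving_snd.ae hξ),
    hmp.ae (Measure.quasiMeasurePreserving_fst.ae (indicatorConstLp_coeFn (p := 2)
      (s := ({1} : Set H) ×ˢ (Set.univ : Set X))
      (hs := (measurableSet_singleton 1).prod MeasurableSet.univ)
      (hμs := by rw [measure_unitFiber]; exact measure_ne_top μ _) (c := (1 : ℂ))))]
    with p h1 h2 h3 h4
  rw [iotaLp, h1, h2, h3]
  rw [← unitFiber] at h4
  rw [h4, iotaZero, twist_apply]
  by_cases h : γ (p.1.2, p.2) = p.1.1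
  · simp [h]
  · have h' : ¬ (p.1.1⁻¹ * γ (p.1.2, p.2) = 1) := fun e => h (inv_mul_eq_one.1 e).symm
    simp [h, h']

theorem enorm_iotaLp_sq (γ : G × X → H) (hγ : Measurable γ) (ξ : Lp ℂ 2 ν) :
    ‖iotaLp ν μ γ hγ ξ‖ₑ ^ 2 = μ Set.univ * ‖ξ‖ₑ ^ 2 := by
  rw [← enorm_unitFiber_sq (H := H) μ, ← mul_pow, iotaLp]
  congr 1
  rw [← ofReal_norm, ← ofReal_norm, ← ofReal_norm, LinearIsometryEquiv.norm_map, norm_tensorLp,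
    ENNReal.ofReal_mul (norm_nonneg _)]

/-- The amplification of bounded operators, twisted by a cocycle. -/
def iotaOp (α : G × X → H) (hα : Measurable α) : (Lp ℂ 2 ν →L[ℂ] Lp ℂ 2 ν) →⋆ₐ[ℂ]
    (Lp ℂ 2 (((Measure.count : Measure H).prod ν).prod μ) →L[ℂ]
      Lp ℂ 2 (((Measure.count : Measure H).prod ν).prod μ)) :=
  amplify ((twistEquiv ν μ α hα).symm.trans (tensorEquiv ((Measure.count : Measure H).prod μ) ν))

theorem iotaOp_apply (α : G × X → H) (hα : Measurable α) (S : Lp ℂ 2 ν →L[ℂ] Lp ℂ 2 ν)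
    (η : Lp ℂ 2 (((Measure.count : Measure H).prod ν).prod μ)) :
    iotaOp ν μ α hα S η = twistEquiv ν μ α hα
      (ampl ((Measure.count : Measure H).prod μ) S ((twistEquiv ν μ α hα).symm η)) := rfl

theorem iotaOp_iotaLp (α : G × X → H) (hα : Measurable α) (S : Lp ℂ 2 ν →L[ℂ] Lp ℂ 2 ν)
    (ξ : Lp ℂ 2 ν) : iotaOp ν μ α hα S (iotaLp ν μ α hα ξ) = iotaLp ν μ α hα (S ξ) := by
  rw [iotaOp_apply, iotaLp, LinearIsometryEquiv.symm_apply_apply, ampl_tensorLp, iotaLp]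

theorem iotaOp_injective [NeZero μ] (α : G × X → H) (hα : Measurable α) :
    Function.Injective (iotaOp ν μ α hα) := by
  intro S T h
  refine ampl_injective (b := unitFiber H μ) ?_ ?_
  · intro h0
    have h1 := enorm_unitFiber_sq (H := H) μ
    rw [h0] at h1
    simp only [enorm_zero, ne_eq, OfNat.ofNat_ne_zero, not_false_eq_true, zero_pow] at h1
    exact NeZero.ne μ (Measure.measure_univ_eq_zero.1 h1.symm)
  · ext1 u
    have h2 := congrArg (fun A => A (twistEquiv ν μ α hα u)) h
    simpa only [iotaOp_apply, LinearIsometryEquiv.symm_apply_apply, EmbeddingLike.apply_eq_iff_eq]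
      using h2

theorem continuous_iotaOp (α : G × X → H) (hα : Measurable α) :
    @Continuous _ _ (ultraweakTopology _) (ultraweakTopology _) (iotaOp ν μ α hα) :=
  continuous_ultraweak_amplify _

variable [MulAction G X] [MeasurableSMul₂ G X] [SMulInvariantMeasure G X μ]

/-- If `S = λ(ξ)`, then `ι(S) = π_l(ι₀(ξ))`. -/
theorem isCrossedPiL_iotaLp {α : G × X → H} (hα : Measurable α) (hc : IsCocycle α) {ξ : Lp ℂ 2 ν}
    {S : Lp ℂ 2 ν →L[ℂ] Lp ℂ 2 ν} (hS : IsPiL ν (groupConv ν) (groupCore ν) ξ S) :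
    IsCrossedPiL (prodAction G H X) ((Measure.count : Measure H).prod ν) μ (iotaLp ν μ α hα ξ)
      (iotaOp ν μ α hα S) := by
  refine isPiL_of_forall fun η => ?_
  have h1 := coeFn_twist_ampl ν μ (Lp.stronglyMeasurable ξ) ((isPiL_group_iff ν).1 hS) hα hα η
    (Lp.stronglyMeasurable η) Filter.EventuallyEq.rfl
  have h2 := crossedConv_congr ν μ (coeFn_iotaLp ν μ α hα (Filter.EventuallyEq.refl _ ξ))
    (Filter.EventuallyEq.refl _ η)
  filter_upwards [h1, h2] with p e1 e2
  rw [iotaOp_apply, e1, e2, crossedConv_graph ν hα (Ξ := fun q => ξ q.1)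
    (fun g x => if_pos rfl) (fun h g x hne => if_neg hne)]
  refine integral_congr_ae (Filter.Eventually.of_forall fun s => ?_)
  -- Factoring `g = s · s⁻¹g`, the cocycle identity gives `α(s⁻¹g, x) α(g, x)⁻¹ h = α(s, s⁻¹gx)⁻¹
  -- h`: the argument produced by the twist is the one in the crossed product.
  have h3 := hc s (s⁻¹ * p.1.2) p.2
  rw [mul_inv_cancel_left, mul_smul] at h3
  simp only [h3]
  simp [mul_assoc]

/-- Right multiplication by `ι₀(f)` is bounded by the `L¹`-norm of `f`. -/
theorem eLpNorm_crossedConv_iotaZero_le {α : G × X → H} (hα : Measurable α) {f : G → ℂ}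
    (hf : Measurable f) (ζ : Lp ℂ 2 (((Measure.count : Measure H).prod ν).prod μ)) :
    eLpNorm (crossedConv (prodAction G H X) ((Measure.count : Measure H).prod ν) ζ (iotaZero α f))
      2 (((Measure.count : Measure H).prod ν).prod μ) ≤ (∫⁻ s, ‖f s‖ₑ ∂ν) * ‖ζ‖ₑ := by
  have h1 : ∫⁻ s, ‖f s‖ₑ ∂ν = ∫⁻ s, ‖f s⁻¹‖ₑ ∂ν :=
    (lintegral_inv_eq_self (μ := ν) fun s => ‖f s‖ₑ).symm
  rw [h1, funext (crossedConv_iotaZero_right (H := H) ν hα f ζ)]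
  refine eLpNorm_integral_mul_le
    (Φ := fun q : G × ((H × G) × X) =>
      ζ ((q.2.1.1 * (α (q.1⁻¹, q.2.2))⁻¹, q.2.1.2 * q.1), q.1⁻¹ • q.2.2))
    ((Lp.stronglyMeasurable ζ).measurable.comp (by fun_prop)) (hf.comp measurable_inv)
    fun s => ?_
  have hT : MeasurePreserving (fun a : G × X => (a.1 * s, s⁻¹ • a.2)) (ν.prod μ) (ν.prod μ) :=
    (measurePreserving_mul_right ν s).prod (measurePreserving_smul s⁻¹ μ)
  -- For fixed `s` the substitution inside `ζ` preserves the measure, so it leaves the `L²` norm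
  -- unchanged and Minkowski yields the factor `‖f‖₁`.
  have hmp := measurePreserving_skew ν μ hT
    (show Measurable fun a : G × X => (α (s⁻¹, a.2))⁻¹ by fun_prop)
  rw [Lp.enorm_def, eLpNorm_two_sq]
  exact (hmp.lintegral_comp (f := fun p => ‖ζ p‖ₑ ^ 2)
    ((Lp.stronglyMeasurable ζ).measurable.enorm.pow_const 2)).le

/-- Needed because an abstract `π_l(ζ)` is known to be a multiplication only on right bounded
vectors. -/
theorem iotaLp_mem_rightBounded {α : G × X → H} (hα : Measurable α) (f : C_c(G, ℂ)) :
    iotaLp ν μ α hα (coreLp ν f) ∈ rightBounded (((Measure.count : Measure H).prod ν).prod μ)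
      (crossedConv (prodAction G H X) ((Measure.count : Measure H).prod ν))
      (crossedCore ((Measure.count : Measure H).prod ν) μ) := by
  have hint : Integrable f ν :=
    f.continuous.integrable_of_hasCompactSupport f.hasCompactSupport
  refine ⟨(∫⁻ s, ‖f s‖ₑ ∂ν).toNNReal, fun ζ _ => ?_⟩
  rw [ENNReal.coe_toNNReal hint.2.ne, eLpNorm_congr_ae (crossedConv_congr ν μ
    (Filter.EventuallyEq.refl _ ζ) (coeFn_iotaLp ν μ α hα (coeFn_coreLp ν f)))]
  exact eLpNorm_crossedConv_iotaZero_le ν μ hα f.continuous.measurable ζ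

theorem enorm_apply_iotaLp_le {α : G × X → H} (hα : Measurable α)
    {ζ : Lp ℂ 2 (((Measure.count : Measure H).prod ν).prod μ)}
    {T : Lp ℂ 2 (((Measure.count : Measure H).prod ν).prod μ) →L[ℂ]
      Lp ℂ 2 (((Measure.count : Measure H).prod ν).prod μ)}
    (hT : IsCrossedPiL (prodAction G H X) ((Measure.count : Measure H).prod ν) μ ζ T)
    (f : C_c(G, ℂ)) :
    ‖T (iotaLp ν μ α hα (coreLp ν f))‖ₑ ≤ (∫⁻ s, ‖f s‖ₑ ∂ν) * ‖ζ‖ₑ := by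
  rw [Lp.enorm_def, eLpNorm_congr_ae (hT.2 _ (iotaLp_mem_rightBounded ν μ hα f)),
    eLpNorm_congr_ae (crossedConv_congr ν μ
    (Filter.EventuallyEq.refl _ ζ) (coeFn_iotaLp ν μ α hα (coeFn_coreLp ν f)))]
  exact eLpNorm_crossedConv_iotaZero_le ν μ hα f.continuous.measurable ζ

end Iota

/-! ### Square roots of positive operators -/

section Sqrt

variable {E : Type*} [NormedAddCommGroup E] [InnerProductSpace ℂ E] [CompleteSpace E]

/-- The root comes from the functional calculus, so it commutes with whatever commutes with `x`;
this carries commutation with right convolutions over to it. -/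
theorem exists_sqrt_of_isPositive {x : E →L[ℂ] E} (hx : x.IsPositive) :
    ∃ y : E →L[ℂ] E, ContinuousLinearMap.adjoint y * y = x ∧
      ∀ R : E →L[ℂ] E, Commute x R → Commute y R := by
  have hx0 : 0 ≤ x := (ContinuousLinearMap.nonneg_iff_isPositive x).2 hx
  refine ⟨CFC.sqrt x, ?_, fun R hR => hR.cfcₙ_nnreal _⟩
  have h1 : star (CFC.sqrt x) = CFC.sqrt x := (CFC.sqrt_nonneg x).isSelfAdjoint
  rw [← ContinuousLinearMap.star_eq_adjoint, h1, CFC.sqrt_mul_sqrt_self x hx0]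

/-- Both squared norms equal `⟪A* A v, v⟫`. This takes the place of a polar decomposition when
`π_l(ζ)` is compared with `ι(√x)`. -/
theorem norm_apply_eq_of_adjoint_mul_self_eq {A B : E →L[ℂ] E}
    (h : ContinuousLinearMap.adjoint A * A = ContinuousLinearMap.adjoint B * B) (v : E) :
    ‖A v‖ = ‖B v‖ := by
  have h1 := congrArg (fun C : E →L[ℂ] E => inner ℂ (C v) v) h
  simp only [ContinuousLinearMap.mul_def, ContinuousLinearMap.comp_apply,
    ContinuousLinearMap.adjoint_inner_left] at h1
  rw [@norm_eq_sqrt_re_inner ℂ, @norm_eq_sqrt_re_inner ℂ, h1]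

end Sqrt

/-! ### Membership in the crossed product, and the trace -/

section Membership

variable {G H X : Type*} [Group G] [TopologicalSpace G] [IsTopologicalGroup G]
  [LocallyCompactSpace G] [T2Space G] [SecondCountableTopology G] [MeasurableSpace G]
  [BorelSpace G] (ν : Measure G) [ν.IsHaarMeasure] [ν.IsMulRightInvariant]
  [Group H] [Countable H] [TopologicalSpace H] [DiscreteTopology H] [MeasurableSpace H]
  [BorelSpace H] [MeasurableSpace X] (μ : Measure X) [IsFiniteMeasure μ]

theorem measurableSet_fst_mem (F : Finset H) :
    MeasurableSet {p : (H × G) × X | p.1.1 ∈ F} :=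
  (measurable_fst.comp measurable_fst) F.measurableSet

/-- The function `(h, g, x) ↦ f(g) 1{c(x) = h}`, cut off to `h ∈ F`. -/
def sliceLp {c : X → H} (hc : Measurable c) (f : C_c(G, ℂ)) (F : Finset H) :
    Lp ℂ 2 (((Measure.count : Measure H).prod ν).prod μ) :=
  restrictOp (measurableSet_fst_mem F)
    (iotaLp ν μ (fun q : G × X => c q.2) (hc.comp measurable_snd) (coreLp ν f))

theorem coeFn_sliceLp {c : X → H} (hc : Measurable c) (f : C_c(G, ℂ)) (F : Finset H) :
    sliceLp ν μ hc f F =ᵐ[((Measure.count : Measure H).prod ν).prod μ]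
      {p : (H × G) × X | p.1.1 ∈ F}.indicator (iotaZero (fun q : G × X => c q.2) f) := by
  filter_upwards [coeFn_restrictOp (measurableSet_fst_mem F)
    (iotaLp ν μ (fun q : G × X => c q.2) (hc.comp measurable_snd) (coreLp ν f)),
    coeFn_iotaLp ν μ (fun q : G × X => c q.2) (hc.comp measurable_snd) (coeFn_coreLp ν f)]
    with p h1 h2
  rw [sliceLp, h1]
  by_cases h : p.1.1 ∈ F
  · rw [Set.indicator_of_mem (by exact h), Set.indicator_of_mem (by exact h), h2]
  · rw [Set.indicator_of_notMem (by exact h), Set.indicator_of_notMem (by exact h)]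

-- Since `c` does not depend on the group variable and `H` is discrete, weak* continuity reduces to
-- continuity of `f`. The finite set `F` makes the support compact in the direction of `H`.
open Classical in
theorem sliceLp_mem_crossedCore {c : X → H} (hc : Measurable c) (f : C_c(G, ℂ)) (F : Finset H) :
    sliceLp ν μ hc f F ∈ crossedCore ((Measure.count : Measure H).prod ν) μ := by
  have hm (h : H) : MeasurableSet {x | c x = h} := hc (measurableSet_singleton h)
  refine ⟨fun k => (if k.1 ∈ F then f k.2 else 0) •
    indicatorConstLp ∞ (hm k.1) (measure_ne_top μ _) (1 : ℂ), fun φ => ?_, ?_, ?_⟩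
  · let I (h : H) : ℂ := ∫ x, (indicatorConstLp ∞ (hm h) (measure_ne_top μ _) (1 : ℂ) :
      Lp ℂ ∞ μ) x * φ x ∂μ
    have h1 (k : H × G) : ∫ x, ((if k.1 ∈ F then f k.2 else 0) •
        indicatorConstLp ∞ (hm k.1) (measure_ne_top μ _) (1 : ℂ) : Lp ℂ ∞ μ) x * φ x ∂μ =
        (if k.1 ∈ F then f k.2 else 0) * I k.1 := by
      rw [← integral_const_mul]
      refine integral_congr_ae ?_
      filter_upwards [Lp.coeFn_smul (if k.1 ∈ F then f k.2 else 0)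
        (indicatorConstLp ∞ (hm k.1) (measure_ne_top μ _) (1 : ℂ))] with x hx
      rw [hx, Pi.smul_apply, smul_eq_mul, mul_assoc]
    simp only [h1]
    refine continuous_prod_of_discrete_left.2 fun h => ?_
    by_cases hF : h ∈ F
    · simp only [hF, if_true]
      exact f.continuous.mul continuous_const
    · simp only [hF, if_false]
      exact continuous_const
  · refine HasCompactSupport.intro (K := (F : Set H) ×ˢ tsupport f)
      (F.finite_toSet.isCompact.prod f.hasCompactSupport) fun k hk => ?_
    have h0 : (if k.1 ∈ F then f k.2 else 0) = 0 := by
      by_cases hF : k.1 ∈ F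
      · rw [if_pos hF]
        by_contra hne
        exact hk ⟨hF, subset_tsupport _ hne⟩
      · rw [if_neg hF]
    simp only [h0, zero_smul]
  · filter_upwards [Measure.ae_ae_of_ae_prod (coeFn_sliceLp ν μ hc f F)] with k hk
    filter_upwards [hk, Lp.coeFn_smul (if k.1 ∈ F then f k.2 else 0)
      (indicatorConstLp ∞ (hm k.1) (measure_ne_top μ _) (1 : ℂ)),
      indicatorConstLp_coeFn (p := ∞) (hs := hm k.1) (hμs := measure_ne_top μ _) (c := (1 : ℂ))]
      with x h1 h2 h3
    rw [h1, h2, Pi.smul_apply, h3]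
    by_cases hF : k.1 ∈ F
    · rw [Set.indicator_of_mem (by exact hF), if_pos hF]
      by_cases hx : c x = k.1 <;> simp [iotaZero, hx]
    · rw [Set.indicator_of_notMem (by exact hF), if_neg hF, zero_smul]

variable [MulAction G X] [MeasurableSMul₂ G X]

variable (G) in
theorem measurable_orbitMap {c : X → H} (hc : Measurable c) :
    Measurable fun q : G × X => (c (q.1 • q.2))⁻¹ := by fun_prop

variable (G) in
theorem measurableSet_orbit_mem {c : X → H} (hc : Measurable c) (F : Finset H) :
    MeasurableSet {p : (H × G) × X | c (p.1.2 • p.2) ∈ F} :=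
  (show Measurable fun p : (H × G) × X => c (p.1.2 • p.2) by fun_prop) F.measurableSet

/-- The operator `1 ⊗ S` composed with the fibrewise translation by `c(gx)`. -/
def sliceOp {c : X → H} (hc : Measurable c) (S : Lp ℂ 2 ν →L[ℂ] Lp ℂ 2 ν) :
    Lp ℂ 2 (((Measure.count : Measure H).prod ν).prod μ) →L[ℂ]
      Lp ℂ 2 (((Measure.count : Measure H).prod ν).prod μ) :=
  (twistEquiv ν μ (fun _ => (1 : H)) measurable_const :
      Lp ℂ 2 (((Measure.count : Measure H).prod μ).prod ν) →L[ℂ]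
      Lp ℂ 2 (((Measure.count : Measure H).prod ν).prod μ)).comp
    ((ampl ((Measure.count : Measure H).prod μ) S).comp
      ((twistEquiv ν μ _ (measurable_orbitMap G hc)).symm :
        Lp ℂ 2 (((Measure.count : Measure H).prod ν).prod μ) →L[ℂ]
        Lp ℂ 2 (((Measure.count : Measure H).prod μ).prod ν)))

theorem sliceOp_apply {c : X → H} (hc : Measurable c) (S : Lp ℂ 2 ν →L[ℂ] Lp ℂ 2 ν)
    (η : Lp ℂ 2 (((Measure.count : Measure H).prod ν).prod μ)) :
    sliceOp ν μ hc S η = twistEquiv ν μ (fun _ => (1 : H)) measurable_const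
      (ampl ((Measure.count : Measure H).prod μ) S
        ((twistEquiv ν μ _ (measurable_orbitMap G hc)).symm η)) := rfl

/-- An operator commuting with the `sliceOp` of all `λ(f)` commutes with the `sliceOp` of all `λ_g`. -/
theorem sliceOp_commute_of_forall {c : X → H} (hc : Measurable c)
    {T : Lp ℂ 2 (((Measure.count : Measure H).prod ν).prod μ) →L[ℂ]
      Lp ℂ 2 (((Measure.count : Measure H).prod ν).prod μ)}
    (h : ∀ f : C_c(G, ℂ), T * sliceOp ν μ hc (lambdaOp ν f) = sliceOp ν μ hc (lambdaOp ν f) * T)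
    (g : G) : T * sliceOp ν μ hc (leftReg ν g) = sliceOp ν μ hc (leftReg ν g) * T := by
  set E₁ := twistEquiv ν μ (fun _ : G × X => (1 : H)) measurable_const
  set E₂ := twistEquiv ν μ _ (measurable_orbitMap G hc)
  set T₁ : Lp ℂ 2 (((Measure.count : Measure H).prod μ).prod ν) →L[ℂ]
      Lp ℂ 2 (((Measure.count : Measure H).prod μ).prod ν) :=
    (E₁.symm : _ →L[ℂ] _).comp (T.comp (E₁ : _ →L[ℂ] _)) with hT₁
  set T₂ : Lp ℂ 2 (((Measure.count : Measure H).prod μ).prod ν) →L[ℂ]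
      Lp ℂ 2 (((Measure.count : Measure H).prod μ).prod ν) :=
    (E₂.symm : _ →L[ℂ] _).comp (T.comp (E₂ : _ →L[ℂ] _)) with hT₂
  -- With the two unitaries moved onto `T`, the relation becomes one between matrix entries on
  -- `L²(G)`, where it passes to strong limits `λ(fₙ) → λ_g`.
  have hiff (S : Lp ℂ 2 ν →L[ℂ] Lp ℂ 2 ν) : T * sliceOp ν μ hc S = sliceOp ν μ hc S * T ↔
      T₁ * ampl ((Measure.count : Measure H).prod μ) S =
        ampl ((Measure.count : Measure H).prod μ) S * T₂ := by
    constructor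
    · intro h
      ext1 u
      have h1 := congrArg (fun A => E₁.symm (A (E₂ u))) h
      simpa [sliceOp_apply, hT₁, hT₂, E₁, E₂] using h1
    · intro h
      ext1 u
      have h1 := congrArg (fun A => E₁ (A (E₂.symm u))) h
      simpa [sliceOp_apply, hT₁, hT₂, E₁, E₂] using h1
  rw [hiff, ampl, mul_amplify_eq_iff]
  intro i j
  ext1 v
  obtain ⟨f, -, hf⟩ := exists_tendsto_lambdaOp ν g
  have h1 (n : ℕ) := (mul_amplify_eq_iff _ T₁ T₂ (lambdaOp ν (f n))).1
    ((hiff (lambdaOp ν (f n))).1 (h (f n))) i j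
  have h2 := ((entryOp (tensorEquiv ((Measure.count : Measure H).prod μ) ν) T₁ i j).continuous.tendsto
    _).comp (hf v)
  refine tendsto_nhds_unique h2 ?_
  refine (hf _).congr fun n => ?_
  exact (congrArg (fun A => A v) (h1 n)).symm

variable [SMulInvariantMeasure G X μ]

/-- Cutting the kernel to `h ∈ F` amounts to cutting the argument to `c(gx) ∈ F`, because the
convolution reads `c` at `s⁻¹gx`, the orbit point of the shifted argument. -/
theorem isCrossedPiL_sliceLp {c : X → H} (hc : Measurable c) (f : C_c(G, ℂ)) (F : Finset H) :
    IsCrossedPiL (prodAction G H X) ((Measure.count : Measure H).prod ν) μ (sliceLp ν μ hc f F)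
      (sliceOp ν μ hc (lambdaOp ν f) * restrictOp (measurableSet_orbit_mem G hc F)) := by
  classical
  refine isPiL_of_forall fun η => ?_
  have h1 := coeFn_twist_ampl ν μ f.continuous.stronglyMeasurable (coeFn_lambdaOp ν f)
    (measurable_const (a := (1 : H))) (measurable_orbitMap G hc)
    (restrictOp (measurableSet_orbit_mem G hc F) η)
    ((Lp.stronglyMeasurable η).indicator (measurableSet_orbit_mem G hc F)) (coeFn_restrictOp _ η)
  have h2 := crossedConv_congr ν μ (coeFn_sliceLp ν μ hc f F) (Filter.EventuallyEq.refl _ η)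
  filter_upwards [h1, h2] with p e1 e2
  rw [ContinuousLinearMap.mul_def, ContinuousLinearMap.comp_apply, sliceOp_apply, e1, e2,
    crossedConv_graph ν (γ := fun q : G × X => c q.2) (hc.comp measurable_snd)
    (Ξ := fun q => if c q.2 ∈ F then f q.1 else 0)]
  · refine integral_congr_ae (Filter.Eventually.of_forall fun s => ?_)
    by_cases hF : c (s⁻¹ • p.1.2 • p.2) ∈ F <;> simp [hF, mul_smul]
  · intro g x
    by_cases hF : c x ∈ F
    · rw [Set.indicator_of_mem (by exact hF)]
      simp [iotaZero, hF]
    · rw [Set.indicator_of_notMem (by exact hF)]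
      simp [hF]
  · intro h g x hne
    refine Set.indicator_apply_eq_zero.2 fun _ => ?_
    exact if_neg hne

/-- `λ_g` involves only the translation `s = g`, and there the frozen function `α(g, ·)` agrees with
the true cocycle; the cocycle identity matches the shifts in `H`. -/
theorem sliceOp_leftReg {α : G × X → H} (hα : Measurable α) (hc : IsCocycle α) (g : G) :
    sliceOp ν μ (c := fun x => α (g, x)) (by fun_prop) (leftReg ν g) =
      iotaOp ν μ α hα (leftReg ν g) := by
  have hampl (u : Lp ℂ 2 (((Measure.count : Measure H).prod μ).prod ν)) :
      ampl ((Measure.count : Measure H).prod μ) (leftReg ν g) u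
        =ᵐ[((Measure.count : Measure H).prod μ).prod ν] fun q => u (q.1, g⁻¹ * q.2) := by
    refine coeFn_ampl_of_forall ν ((Lp.stronglyMeasurable u).comp_measurable (by fun_prop))
      (Filter.Eventually.of_forall fun y v hv => ?_)
    filter_upwards [Lp.coeFn_compMeasurePreserving v (measurePreserving_mul_left ν g⁻¹),
      (measurePreserving_mul_left ν g⁻¹).quasiMeasurePreserving.ae hv] with s h1 h2
    exact h1.trans h2
  have hshift : Measure.QuasiMeasurePreserving
      (fun q : (H × X) × G => (q.1, g⁻¹ * q.2)) (((Measure.count : Measure H).prod μ).prod ν)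
      (((Measure.count : Measure H).prod μ).prod ν) :=
    ((MeasurePreserving.id _).prod (measurePreserving_mul_left ν g⁻¹)).quasiMeasurePreserving
  have key {β β' : G × X → H} (hβ : Measurable β) (hβ' : Measurable β')
      (η : Lp ℂ 2 (((Measure.count : Measure H).prod ν).prod μ)) :
      twistEquiv ν μ β hβ (ampl ((Measure.count : Measure H).prod μ) (leftReg ν g)
        ((twistEquiv ν μ β' hβ').symm η)) =ᵐ[((Measure.count : Measure H).prod ν).prod μ]
      fun p => η ((β' (g⁻¹ * p.1.2, p.2) * (p.1.1⁻¹ * β (p.1.2, p.2))⁻¹, g⁻¹ * p.1.2), p.2) := by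
    have hmp := (measurePreserving_twist ν μ β hβ).quasiMeasurePreserving
    filter_upwards [coeFn_twistEquiv ν μ β hβ (ampl ((Measure.count : Measure H).prod μ)
        (leftReg ν g) ((twistEquiv ν μ β' hβ').symm η)), hmp.ae (hampl _),
      hmp.ae (hshift.ae (coeFn_twistEquiv_symm ν μ β' hβ' η))] with p h1 h2 h3
    rw [h1, h2, h3]
    rfl
  ext1 η
  refine Lp.ext ?_
  rw [sliceOp_apply, iotaOp_apply]
  filter_upwards [key measurable_const (measurable_orbitMap G (c := fun x => α (g, x))
    (by fun_prop)) η, key hα hα η] with p h1 h2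
  rw [h1, h2]
  have h3 := hc g (g⁻¹ * p.1.2) p.2
  rw [mul_inv_cancel_left] at h3
  simp [h3, mul_assoc]

/-- The twisted amplification of the group von Neumann algebra lies in the crossed product. -/
theorem iotaOp_mem_crossedProduct {α : G × X → H} (hα : Measurable α) (hc : IsCocycle α)
    {S : Lp ℂ 2 ν →L[ℂ] Lp ℂ 2 ν} (hS : S ∈ (groupVN ν).toStarSubalgebra) :
    iotaOp ν μ α hα S ∈ (crossedProduct (prodAction G H X)
      ((Measure.count : Measure H).prod ν) μ).toStarSubalgebra := by
  set M : Set (Lp ℂ 2 (((Measure.count : Measure H).prod ν).prod μ) →L[ℂ]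
      Lp ℂ 2 (((Measure.count : Measure H).prod ν).prod μ)) :=
    {T | ∃ ξ ∈ crossedCore ((Measure.count : Measure H).prod ν) μ,
      IsCrossedPiL (prodAction G H X) ((Measure.count : Measure H).prod ν) μ ξ T}
  have key : ∀ T ∈ StarSubalgebra.centralizer ℂ M, ∀ g : G,
      T * iotaOp ν μ α hα (leftReg ν g) = iotaOp ν μ α hα (leftReg ν g) * T := by
    intro T hT g
    rw [StarSubalgebra.mem_centralizer_iff] at hT
    have hcg : Measurable fun x => α (g, x) := by fun_prop
    rw [← sliceOp_leftReg ν μ hα hc g]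
    refine sliceOp_commute_of_forall ν μ hcg (fun f => ?_) g
    -- `T` commutes with each cut-off slice, since these are generators; the strong limit over `F`
    -- removes the cut-off.
    have h1 (F : Finset H) := (hT _ ⟨_, sliceLp_mem_crossedCore ν μ hcg f F,
      isCrossedPiL_sliceLp ν μ hcg f F⟩).1
    ext1 η
    have h2 (u) := tendsto_restrictOp (φ := fun p : (H × G) × X => α (g, p.1.2 • p.2))
      (fun F p => Iff.rfl) (measurableSet_orbit_mem G hcg) u
      (m := ((Measure.count : Measure H).prod ν).prod μ)
    have h3 := ((T * sliceOp ν μ hcg (lambdaOp ν f)).continuous.tendsto _).comp (h2 η)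
    have h4 := ((sliceOp ν μ hcg (lambdaOp ν f)).continuous.tendsto _).comp (h2 (T η))
    refine tendsto_nhds_unique h3 (h4.congr fun F => ?_)
    exact congrArg (fun A => A η) (h1 F)
  change iotaOp ν μ α hα S ∈ StarSubalgebra.centralizer ℂ
    (StarSubalgebra.centralizer ℂ M : Set _)
  rw [StarSubalgebra.mem_centralizer_iff]
  have key2 : ∀ T ∈ StarSubalgebra.centralizer ℂ M,
      T * iotaOp ν μ α hα S = iotaOp ν μ α hα S * T := by
    intro T hT
    refine commute_amplify_of_mem_generatedVN _ ?_ ?_ hS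
    · rintro _ ⟨g, rfl⟩
      exact key T hT g
    · rintro _ ⟨g, rfl⟩
      exact key _ (star_mem hT) g
  exact fun T hT => ⟨key2 T hT, key2 _ (star_mem hT)⟩

theorem crossedTrace_iotaOp [NeZero μ] {α : G × X → H} (hα : Measurable α) (hc : IsCocycle α)
    {x : Lp ℂ 2 ν →L[ℂ] Lp ℂ 2 ν} (hx : x ∈ (groupVN ν).toStarSubalgebra) (hpos : x.IsPositive) :
    (μ Set.univ)⁻¹ * crossedTrace (prodAction G H X) ((Measure.count : Measure H).prod ν) μ
      (iotaOp ν μ α hα x) = groupTrace ν x := by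
  have hμ0 : μ Set.univ ≠ 0 := fun h => NeZero.ne μ (Measure.measure_univ_eq_zero.1 h)
  have hμt : μ Set.univ ≠ ∞ := measure_ne_top μ _
  have hmap (y : Lp ℂ 2 ν →L[ℂ] Lp ℂ 2 ν) :
      iotaOp ν μ α hα (ContinuousLinearMap.adjoint y * y) =
        ContinuousLinearMap.adjoint (iotaOp ν μ α hα y) * iotaOp ν μ α hα y := by
    rw [← ContinuousLinearMap.star_eq_adjoint, map_mul, map_star,
      ContinuousLinearMap.star_eq_adjoint]
  refine le_antisymm ?_ ?_
  · refine le_iInf fun ξ => le_iInf fun S => le_iInf fun hS => le_iInf fun hxS => ?_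
    rw [mul_comm, ← div_eq_mul_inv]
    refine ENNReal.div_le_of_le_mul ?_
    rw [mul_comm, ← enorm_iotaLp_sq (H := H) ν μ α hα]
    refine iInf_le_of_le (iotaLp ν μ α hα ξ) (iInf_le_of_le (iotaOp ν μ α hα S)
      (iInf_le_of_le (isCrossedPiL_iotaLp ν μ hα hc hS) (iInf_le _ ?_)))
    rw [hxS, hmap]
  · rw [mul_comm, ← div_eq_mul_inv, ENNReal.le_div_iff_mul_le (Or.inl hμ0) (Or.inl hμt)]
    refine le_iInf fun ζ => le_iInf fun T => le_iInf fun hT => le_iInf fun hxT => ?_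
    -- `T` need not lie in the image of `ι`, so it is replaced by `ι(y)`, which has the same
    -- absolute square and can be compared with `L(G)`.
    obtain ⟨y, hyy, hcomm⟩ := exists_sqrt_of_isPositive hpos
    have hyc (f : C_c(G, ℂ)) : Commute y (rightConvOp ν f) := hcomm _ (rightConvOp_commute ν hx f)
    have hle (f : C_c(G, ℂ)) (hf : ∫ s, ‖f s‖ ∂ν = 1) :
        μ Set.univ * ‖y (coreLp ν f)‖ₑ ^ 2 ≤ ‖ζ‖ₑ ^ 2 := by
      have h1 : ∫⁻ s, ‖f s‖ₑ ∂ν = 1 := by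
        have hint : Integrable f ν :=
          f.continuous.integrable_of_hasCompactSupport f.hasCompactSupport
        rw [← ofReal_integral_norm_eq_lintegral_enorm hint, hf, ENNReal.ofReal_one]
      have h2 := enorm_apply_iotaLp_le ν μ hα hT f
      have h3 := norm_apply_eq_of_adjoint_mul_self_eq (A := T) (B := iotaOp ν μ α hα y)
        (by rw [← hxT, ← hmap, hyy])
        (iotaLp ν μ α hα (coreLp ν f))
      rw [h1, one_mul, ← ofReal_norm, h3, iotaOp_iotaLp, ofReal_norm] at h2
      rw [← enorm_iotaLp_sq (H := H) ν μ α hα]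
      exact pow_le_pow_left₀ zero_le h2 2
    -- The bound on `‖y f‖` obtained from `μ(X) ‖y f‖² ≤ ‖ζ‖²`; the weak limit inherits it, which is
    -- the required norm inequality.
    set c : ℝ := Real.sqrt (‖ζ‖ ^ 2 / (μ Set.univ).toReal) with hcdef
    have hμpos : 0 < (μ Set.univ).toReal := ENNReal.toReal_pos hμ0 hμt
    obtain ⟨ξ, hξ, hpi⟩ := exists_isPiL_of_bounded ν hyc (c := c) (by
      intro f hf
      refine Real.le_sqrt_of_sq_le ?_
      rw [le_div_iff₀ hμpos]
      have h1 := ENNReal.toReal_mono (by simp) (hle f hf)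
      simp only [ENNReal.toReal_mul, ENNReal.toReal_pow, toReal_enorm] at h1
      linarith)
    have h1 : groupTrace ν x ≤ ‖ξ‖ₑ ^ 2 :=
      iInf_le_of_le ξ (iInf_le_of_le y (iInf_le_of_le hpi (iInf_le _ hyy.symm)))
    refine (mul_le_mul' h1 le_rfl).trans ?_
    have h2 : ‖ξ‖ ^ 2 * (μ Set.univ).toReal ≤ ‖ζ‖ ^ 2 := by
      rw [← le_div_iff₀ hμpos, ← Real.sq_sqrt (show 0 ≤ ‖ζ‖ ^ 2 / (μ Set.univ).toReal by positivity)]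
      exact pow_le_pow_left₀ (norm_nonneg _) hξ 2
    rw [← ENNReal.toReal_le_toReal (ENNReal.mul_ne_top (by simp) hμt) (by simp)]
    simpa only [ENNReal.toReal_mul, ENNReal.toReal_pow, toReal_enorm] using h2

end Membership

end CocycleTransference

end

open CocycleTransference
theorem mainTheorem9
    {G H X : Type*}
    -- a unimodular locally compact second countable group with a Haar measure
    [Group G] [TopologicalSpace G] [IsTopologicalGroup G] [LocallyCompactSpace G] [T2Space G]
    [SecondCountableTopology G] [MeasurableSpace G] [BorelSpace G]
    (ν : Measure G) [ν.IsHaarMeasure] [ν.IsMulRightInvariant]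
    -- a countable discrete group, with counting measure
    [Group H] [Countable H] [TopologicalSpace H] [DiscreteTopology H]
    [MeasurableSpace H] [BorelSpace H]
    -- a nonzero finite measure space with a measure preserving action
    [MeasurableSpace X] (μ : Measure X) [IsFiniteMeasure μ] [NeZero μ]
    [MulAction G X] [MeasurableSMul₂ G X] [SMulInvariantMeasure G X μ]
    (α : G × X → H) (hα : Measurable α) (hcocycle : IsCocycle α) :
    ∃ ι : (groupVN ν).toStarSubalgebra →⋆ₐ[ℂ]
        (crossedProduct (prodAction G H X) ((Measure.count : Measure H).prod ν) μ).toStarSubalgebra,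
      -- `ι (λ(f)) = π_l(ι₀(f))` for `f ∈ C_c(G)`
      (∀ f : C_c(G, ℂ), ∃ ξ : Lp ℂ 2 (((Measure.count : Measure H).prod ν).prod μ),
        ξ =ᵐ[((Measure.count : Measure H).prod ν).prod μ] iotaZero α f ∧
        IsCrossedPiL (prodAction G H X) ((Measure.count : Measure H).prod ν) μ ξ
          (ι (lambdaVN ν f)).1) ∧
      -- trace preserving, for the trace of the crossed product normalized by `μ(X)`
      (∀ x : (groupVN ν).toStarSubalgebra, x.1.IsPositive →
        (μ Set.univ)⁻¹ *
            crossedTrace (prodAction G H X) ((Measure.count : Measure H).prod ν) μ (ι x).1 =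
          groupTrace ν x.1) ∧
      -- normal
      @Continuous _ _ (weakStarTopology _) (weakStarTopology _) ι ∧
      Function.Injective ι := by
  let ι := ((iotaOp ν μ α hα).comp (groupVN ν).toStarSubalgebra.subtype).codRestrict
    (crossedProduct (prodAction G H X) ((Measure.count : Measure H).prod ν) μ).toStarSubalgebra
    (fun x => iotaOp_mem_crossedProduct ν μ hα hcocycle x.2)
  have hι (x : (groupVN ν).toStarSubalgebra) : (ι x).1 = iotaOp ν μ α hα x.1 := rfl
  refine ⟨ι, fun f => ⟨iotaLp ν μ α hα (coreLp ν f), coeFn_iotaLp ν μ α hα (coeFn_coreLp ν f), ?_⟩,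
    fun x hx => ?_, ?_, ?_⟩
  · rw [hι]
    exact isCrossedPiL_iotaLp ν μ hα hcocycle (isPiL_coreLp ν f)
  · rw [hι]
    exact crossedTrace_iotaOp ν μ hα hcocycle x.2 hx
  · refine continuous_induced_rng.2 ?_
    change @Continuous _ _ (weakStarTopology _) (ultraweakTopology _)
      (iotaOp ν μ α hα ∘ Subtype.val)
    exact @Continuous.comp _ _ _ (weakStarTopology _) (ultraweakTopology _) (ultraweakTopology _)
      _ _ (continuous_iotaOp ν μ α hα) continuous_induced_dom
  · intro x y h
    refine Subtype.ext (iotaOp_injective ν μ α hα ?_)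
    rw [← hι, ← hι, h]
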